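/- **Setting.** Let $G$ be a finite simple undirected graph, let $\epsilon\in(0,1]$ be such that $1/\epsilon$ is a power of $2$, let $h\in\{\frac12,\frac14,\frac18,\dots,\frac{\epsilon^2}{64}\}$ be a scale, and let $M$ be a matching of $G$. Put $\ell_{\max}=3/\epsilon$, $\mathsf{limit}_h=\frac6h+1$ and $\tau_{\max}(h)=\frac{72}{h\epsilon}$. Each edge $\{u,v\}$ is represented by the two arcs $(u,v)$ and $(v,u)$; arcs are matched or unmatched according to whether the edge is in $M$. A vertex is free if it has no incident edge in $M$. **Data.** Every free vertex $\alpha$ keeps a structure $S_\alpha=(G_\alpha,\Omega_\alpha,w'_\alpha)$: a set of vertices and arcs $G_\alpha$, a laminar family $\Omega_\alpha$ of blossoms, and a working vertex $w'_\alpha$. Let $\Omega$ consist of all trivial blossoms $\{v\}$ and all blossoms of the structures, and let $\Omega(v)$ be the largest blossom in $\Omega$ that contains $v$. Contracting the blossoms turns $G_\alpha$ into a tree $T'_\alpha$ rooted at $\Omega(\alpha)$, whose arcs $(\Omega(x),\Omega(y))$, for arcs $(x,y)$ of $G_\alpha$ with $\Omega(x)\ne\Omega(y)$, point from parent to child; its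 vertices at even depth are called outer, those at odd depth inner. The working vertex $w'_\alpha$ is $\emptyset$ or an outer vertex of $T'_\alpha$; $S_\alpha$ is *active* if $w'_\alpha\neq\emptyset$. Every matched arc $a$ has a label $\ell(a)$. Initially $G_\alpha$ is the single vertex $\alpha$, $\Omega_\alpha=\{\{\alpha\}\}$, $w'_\alpha=\{\alpha\}$, all labels are $\ell_{\max}+1$, no vertex is removed, and the set $\mathcal P$ of found paths is empty. **Operations** (each marks the structures involved as modified). * *Augment* on an arc $(u,v)$ such that $\Omega(u)$, $\Omega(v)$ are outer vertices of different structures $S_\alpha$, $S_\beta$: add to $\mathcal P$ an augmenting path from $\alpha$ to $\beta$ that uses only $\{u,v\}$ and edges of $G_\alpha$ and $G_\beta$, and remove $S_\alpha$, $S_\beta$ and all their vertices. * *Contract* on an arc $(u,v)$ such that $\Omega(u)=w'_\alpha$ and $\Omega(v)\neq\Omega(u)$ is an outer vertex of $T'_\alpha$: let $B$ be the union of the blossoms on the path of $T'_\alpha$ between $\Omega(u)$ and $\Omega(v)$; add $B$ to $\Omega_\alpha$ and $(u,v)$ to $G_\alpha$, set $w'_\alpha=B$, and set to $0$ the labels of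 all matched arcs with both ends in $B$. * *Overtake* on an unmatched arc $(u,v)$ with $\Omega(u)=w'_\alpha$, a matched arc $(v,t)$ and a label $k$: set $\ell((v,t))=k$. If $(v,t)$ is in no structure, add $(u,v)$, $(v,t)$ and the trivial blossoms $\{v\},\{t\}$ to $S_\alpha$ and set $w'_\alpha=\Omega(t)$. If $(v,t)$ is in $S_\beta$, let $(p,v)$ be the unmatched arc of $G_\beta$ from the parent of $\Omega(v)$. If $\beta=\alpha$, replace $(p,v)$ by $(u,v)$ in $G_\alpha$ and set $w'_\alpha=\Omega(t)$. If $\beta\ne\alpha$, delete $(p,v)$ from $G_\beta$, add $(u,v)$ to $G_\alpha$, and move from $S_\beta$ to $S_\alpha$ the vertices whose blossoms lie in the subtree of $\Omega(v)$, the arcs between such vertices and the blossoms consisting of such vertices; if $w'_\beta$ was in the subtree of $\Omega(t)$, set $w'_\alpha$ to the old $w'_\beta$ and then $w'_\beta=\Omega(p)$, and otherwise set $w'_\alpha=\Omega(t)$. **A phase** at scale $h$ consists of $\tau_{\max}(h)$ pass-bundles. Each pass-bundle runs as follows. 1. Mark each structure as on hold if it has at least $\mathsf{limit}_h$ vertices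 and as not on hold otherwise, and mark every structure as not modified. 2. (*Extend-Active-Path*) Read all arcs $(u,v)$ of $G$, each once, in an arbitrary order. Skip $(u,v)$ if $u$ or $v$ is removed, if $\Omega(u)=\Omega(v)$, if $(u,v)$ is matched, if $\Omega(u)$ is not the working vertex of a structure, or if that structure $S_\alpha$ is modified or on hold. Otherwise: if $\Omega(v)$ is an outer vertex, apply Contract when it lies in $S_\alpha$ and Augment when it lies in another structure; if $\Omega(v)$ is not outer, let $(v,t)$ be the matched arc with tail $v$, let $d=0$ if $\Omega(u)$ is a root and otherwise let $d$ be the label of the matched arc entering $\Omega(u)$ in the contracted graph, and if $d+1<\ell((v,t))$ apply Overtake with $k=d+1$. 3. (*Contract-and-Augment*) In arbitrary order, as long as there are a structure $S_\alpha$ and an arc $(u,v)$ of $G$ between vertices of $G_\alpha$ such that $\Omega(u)=w'_\alpha$ and $\Omega(v)\ne\Omega(u)$ is outer, apply Contract to it. Then read all arcs of $G$, each once, in an arbitrary order, and apply Augment to every arc $(u,v)$ for which, when it is read, $\Omega(u)$ and $\Omega(v)$ are outer vertices of different structures. 4. (*Backtrack-Stuck-Structures*) For every active structure that is neither on hold nor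 modified, replace $w'_\alpha$ by its grandparent in $T'_\alpha$ if $w'_\alpha$ is not the root, and by $\emptyset$ if it is the root. **Lemma (upper bound on the number of active structures).** Consider a phase for scale $h$, and let $M$ be the matching at the beginning of the phase. Then, whatever the orders of the streams and the other arbitrary choices, at the end of the phase at most $h|M|$ structures are active. -/

import Mathlib

namespace MatchingPhase

noncomputable section

open scoped Classical

/-! ## Data -/

/-- The data `(G_α, Ω_α, w'_α)` kept by a free vertex `α`. The subgraph `G_α` is given by its vertices
and its arcs (tree arcs point from parent to child), a blossom in `Ω_α` by its vertex set (its edge set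
is the set of edges of `G_α` inside it), and the working vertex `w'_α` is `none` or a vertex of the
contracted tree, that is, a blossom. -/
structure FreeStructure (V : Type*) where
  verts : Finset V
  arcs : Finset (V × V)
  blossoms : Finset (Finset V)
  working : Option (Finset V)

namespace FreeStructure

/-- No structure: used for vertices that are not free and for structures that have been removed. -/
def empty (V : Type*) : FreeStructure V := ⟨∅, ∅, ∅, none⟩

/-- The initial structure of a free vertex `α`. -/
def single {V : Type*} (α : V) : FreeStructure V := ⟨{α}, ∅, {{α}}, some {α}⟩

end FreeStructure

/-- What the algorithm stores during a phase. -/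
structure PhaseState (V : Type*) where
  /-- the structure of each free vertex -/
  struct : V → FreeStructure V
  /-- the labels; only the values at matched arcs are meaningful -/
  label : V × V → ℕ
  /-- the vertices removed so far in this phase -/
  removed : Set V
  /-- the free vertices whose structure is marked as on hold -/
  onHold : Set V
  /-- the free vertices whose structure is marked as modified -/
  modified : Set V
  /-- the augmenting paths found so far, each as the list of its vertices -/
  paths : Set (List V)

variable {V : Type*}

/-- A vertex with no incident matched edge. -/
def IsFree {G : SimpleGraph V} (M : G.Subgraph) (v : V) : Prop := ∀ w, ¬ M.Adj v w

/-- `p` is (the vertex list of) an augmenting path from `α` to `β`: a simple path of `G` whose edges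
are alternately unmatched and matched, with distinct free end vertices. -/
def IsAugmentingPath {G : SimpleGraph V} (M : G.Subgraph) (α β : V) (p : List V) : Prop :=
  IsFree M α ∧ IsFree M β ∧ α ≠ β ∧ p.head? = some α ∧ p.getLast? = some β ∧ p.Nodup ∧
    ∀ i x y, p[i]? = some x → p[i + 1]? = some y → G.Adj x y ∧ (M.Adj x y ↔ Odd i)

namespace PhaseState

/-! ## The contracted graph and the alternating trees -/

section Views

variable [Fintype V] (s : PhaseState V)

/-- The family `Ω`: all trivial blossoms and all blossoms of the structures. -/
def family : Finset (Finset V) :=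
  Finset.univ.image (fun v : V => ({v} : Finset V)) ∪
    Finset.univ.biUnion fun α => (s.struct α).blossoms

/-- `Ω(v)`, the root blossom containing `v`. As `Ω` is laminar, the blossoms containing `v` form a
chain and their union is the largest one. -/
def root (v : V) : Finset V := (s.family.filter fun B => v ∈ B).sup id

/-- `(X, Y)` is an arc of the contracted tree `T'_α = G_α / Ω_α`; `X` is then the parent of `Y`. -/
def TreeArc (α : V) (X Y : Finset V) : Prop :=
  X ≠ Y ∧ ∃ a ∈ (s.struct α).arcs, s.root a.1 = X ∧ s.root a.2 = Y

/-- `X` is an ancestor of `Y` (or `Y` itself) in `T'_α`. -/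
def Ancestor (α : V) (X Y : Finset V) : Prop := Relation.ReflTransGen (s.TreeArc α) X Y

/-- `T'_α` has a path with `n` arcs from its root `Ω(α)` to `X`. -/
inductive Depth (α : V) : ℕ → Finset V → Prop
  | base : α ∈ (s.struct α).verts → Depth α 0 (s.root α)
  | step {n : ℕ} {X Y : Finset V} : Depth α n X → s.TreeArc α X Y → Depth α (n + 1) Y

/-- `X` is an outer vertex of `T'_α`. -/
def IsOuter (α : V) (X : Finset V) : Prop := ∃ n, Even n ∧ s.Depth α n X

/-- `(x, y)` is a non-blossom matched arc whose head in the contracted graph is `Ω(u)`. -/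
def MatchedInto {G : SimpleGraph V} (M : G.Subgraph) (u x y : V) : Prop :=
  M.Adj x y ∧ s.root x ≠ s.root y ∧ s.root y = s.root u

/-- `distance(u) = d`: it is `0` if `Ω(u)` is a free vertex of the contracted graph, and otherwise the
label of the matched arc of the contracted graph whose head is `Ω(u)`. -/
def IsDistance {G : SimpleGraph V} (M : G.Subgraph) (u : V) (d : ℕ) : Prop :=
  (d = 0 ∧ ¬ ∃ x y, s.MatchedInto M u x y) ∨ ∃ x y, s.MatchedInto M u x y ∧ d = s.label (x, y)

/-- The structure of the free vertex `α` is active: its working vertex is not `∅`. (A removed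
structure has no working vertex.) -/
def IsActive {G : SimpleGraph V} (M : G.Subgraph) (α : V) : Prop :=
  IsFree M α ∧ (s.struct α).working ≠ none

/-! ## The basic operations -/

/-- The vertex set of the blossom closed by the arc `(u, v)` in `T'_α`: the union of the vertices of
`T'_α` on the tree path between `Ω(u)` and `Ω(v)`, which are the ancestors of `Ω(u)` or `Ω(v)` that lie
below (or are) the lowest common ancestor. -/
def cycle (α u v : V) : Finset V :=
  Finset.univ.filter fun x =>
    (s.Ancestor α (s.root x) (s.root u) ∨ s.Ancestor α (s.root x) (s.root v)) ∧
      ∀ Y, s.Ancestor α Y (s.root u) → s.Ancestor α Y (s.root v) → s.Ancestor α Y (s.root x)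

/-- `Contract` on the arc `(u, v)`, in the structure of `α`. -/
def contract {G : SimpleGraph V} (M : G.Subgraph) (α u v : V) : PhaseState V :=
  { s with
    struct := Function.update s.struct α
      { verts := (s.struct α).verts
        arcs := insert (u, v) (s.struct α).arcs
        blossoms := insert (s.cycle α u v) (s.struct α).blossoms
        working := some (s.cycle α u v) }
    label := fun a =>
      if M.Adj a.1 a.2 ∧ a.1 ∈ s.cycle α u v ∧ a.2 ∈ s.cycle α u v then 0 else s.label a
    modified := insert α s.modified }

/-- The edge `{x, y}` belongs to `G_α`. -/
def HasEdge (α x y : V) : Prop := (x, y) ∈ (s.struct α).arcs ∨ (y, x) ∈ (s.struct α).arcs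

/-- `p` is an augmenting path that `Augment` may produce from the arc `(u, v)` between the structures
of `α` and `β`: it runs from `α` to `β` along edges of `G_α`, the edge `{u, v}`, and edges of `G_β`. -/
def IsFoundPath {G : SimpleGraph V} (M : G.Subgraph) (α β u v : V) (p : List V) : Prop :=
  IsAugmentingPath M α β p ∧
    ∀ i x y, p[i]? = some x → p[i + 1]? = some y →
      s.HasEdge α x y ∨ s.HasEdge β x y ∨ (x, y) = (u, v)

/-- `Augment`, with `p` the augmenting path found between the structures of `α` and `β`. -/
def augment (α β : V) (p : List V) : PhaseState V :=
  { s with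
    struct := Function.update (Function.update s.struct α (FreeStructure.empty V)) β
      (FreeStructure.empty V)
    removed := s.removed ∪ {x | x ∈ (s.struct α).verts ∨ x ∈ (s.struct β).verts}
    modified := s.modified ∪ {α, β}
    paths := insert p s.paths }

/-- `Overtake`, Case 1: the matched arc `(v, t)` is not in any structure. -/
def overtakeNew (α u v t : V) (k : ℕ) : PhaseState V :=
  { s with
    struct := Function.update s.struct α
      { verts := insert v (insert t (s.struct α).verts)
        arcs := insert (u, v) (insert (v, t) (s.struct α).arcs)
        blossoms := insert {v} (insert {t} (s.struct α).blossoms)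
        working := some (s.root t) }
    label := Function.update s.label (v, t) k
    modified := insert α s.modified }

/-- `Overtake`, Case 2.1: `(v, t)` is in the structure of `α`; `(p, v)` is the arc from the parent. -/
def overtakeSame (α u v t p : V) (k : ℕ) : PhaseState V :=
  { s with
    struct := Function.update s.struct α
      { s.struct α with
        arcs := insert (u, v) ((s.struct α).arcs.erase (p, v))
        working := some (s.root t) }
    label := Function.update s.label (v, t) k
    modified := insert α s.modified }

/-- The vertices of `G_β` that lie in the subtree of `Ω(v)` in `T'_β`. -/
def subtree (β v : V) : Finset V :=
  (s.struct β).verts.filter fun x => s.Ancestor β (s.root v) (s.root x)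

/-- The working vertex of `β` lies in the subtree of `Ω(t)` in `T'_β`. -/
def WorkingBelow (β t : V) : Prop :=
  ∃ W, (s.struct β).working = some W ∧ s.Ancestor β (s.root t) W

/-- `Overtake`, Case 2.2: `(v, t)` is in the structure of `β ≠ α`; `(p, v)` is the arc from the
parent. -/
def overtakeOther (α β u v t p : V) (k : ℕ) : PhaseState V :=
  { s with
    struct := Function.update (Function.update s.struct β
        { verts := (s.struct β).verts \ s.subtree β v
          arcs := ((s.struct β).arcs.erase (p, v)).filter fun a =>
            ¬ (a.1 ∈ s.subtree β v ∧ a.2 ∈ s.subtree β v)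
          blossoms := (s.struct β).blossoms.filter fun B => ¬ B ⊆ s.subtree β v
          working := if s.WorkingBelow β t then some (s.root p) else (s.struct β).working })
      α
        { verts := (s.struct α).verts ∪ s.subtree β v
          arcs := insert (u, v) ((s.struct α).arcs ∪ (s.struct β).arcs.filter fun a =>
            a.1 ∈ s.subtree β v ∧ a.2 ∈ s.subtree β v)
          blossoms := (s.struct α).blossoms ∪
            (s.struct β).blossoms.filter fun B => B ⊆ s.subtree β v
          working := if s.WorkingBelow β t then (s.struct β).working else some (s.root t) }
    label := Function.update s.label (v, t) k
    modified := insert β (insert α s.modified) }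

/-- `s'` results from `Overtake` by `α` on the unmatched arc `(u, v)`, the matched arc `(v, t)` and the
new label `k`. -/
inductive Overtake {G : SimpleGraph V} (M : G.Subgraph) (α u v t : V) (k : ℕ) : PhaseState V → Prop
  | fresh : (∀ β, (v, t) ∉ (s.struct β).arcs) → Overtake M α u v t k (s.overtakeNew α u v t k)
  | same (p : V) : (v, t) ∈ (s.struct α).arcs → (p, v) ∈ (s.struct α).arcs → ¬ M.Adj p v →
      s.root p ≠ s.root v → Overtake M α u v t k (s.overtakeSame α u v t p k)
  | other (β p : V) : β ≠ α → (v, t) ∈ (s.struct β).arcs → (p, v) ∈ (s.struct β).arcs →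
      ¬ M.Adj p v → s.root p ≠ s.root v →
      Overtake M α u v t k (s.overtakeOther α β u v t p k)

/-! ## The procedures of a pass-bundle -/

/-- The arc `(u, v)` passes the tests at the beginning of the loop of `Extend-Active-Path`, and `Ω(u)`
is the working vertex of the structure of `α`. -/
def Extendable {G : SimpleGraph V} (M : G.Subgraph) (α u v : V) : Prop :=
  u ∉ s.removed ∧ v ∉ s.removed ∧ s.root u ≠ s.root v ∧
    (s.struct α).working = some (s.root u) ∧ ¬ M.Adj u v ∧ α ∉ s.modified ∧ α ∉ s.onHold

/-- `Extend-Active-Path` performs an operation when it reads the arc `(u, v)`. -/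
inductive ExtendOp {G : SimpleGraph V} (M : G.Subgraph) (u v : V) : PhaseState V → Prop
  | contract (α : V) : s.Extendable M α u v → s.IsOuter α (s.root v) →
      ExtendOp M u v (s.contract M α u v)
  | augment (α β : V) (p : List V) : s.Extendable M α u v → β ≠ α → s.IsOuter β (s.root v) →
      s.IsFoundPath M α β u v p → ExtendOp M u v (s.augment α β p)
  | overtake (α t : V) (d : ℕ) (s' : PhaseState V) : s.Extendable M α u v →
      (¬ ∃ β, s.IsOuter β (s.root v)) → M.Adj v t → s.IsDistance M u d →
      d + 1 < s.label (v, t) → s.Overtake M α u v t (d + 1) s' → ExtendOp M u v s'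

/-- The iteration of `Extend-Active-Path` that reads the arc `a`; nothing happens if no operation
applies. -/
def ExtendStep {G : SimpleGraph V} (M : G.Subgraph) (a : V × V) (s' : PhaseState V) : Prop :=
  s.ExtendOp M a.1 a.2 s' ∨ (¬ ∃ s'', s.ExtendOp M a.1 a.2 s'') ∧ s' = s

/-- One contraction in Step 1 of `Contract-and-Augment`. -/
def ContractStep {G : SimpleGraph V} (M : G.Subgraph) (s s' : PhaseState V) : Prop :=
  ∃ α u v, G.Adj u v ∧ u ∈ (s.struct α).verts ∧ v ∈ (s.struct α).verts ∧
    (s.struct α).working = some (s.root u) ∧ s.root v ≠ s.root u ∧ s.IsOuter α (s.root v) ∧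
    s' = s.contract M α u v

/-- Step 1 of `Contract-and-Augment`: contract, in any order, until no contraction is possible. -/
def ContractAll {G : SimpleGraph V} (M : G.Subgraph) (s s' : PhaseState V) : Prop :=
  Relation.ReflTransGen (ContractStep M) s s' ∧ ¬ ∃ s'', ContractStep M s' s''

/-- `Step 2` of `Contract-and-Augment` performs an augmentation when it reads the arc `(u, v)`. -/
def AugmentOp {G : SimpleGraph V} (M : G.Subgraph) (u v : V) (s' : PhaseState V) : Prop :=
  ∃ α β p, α ≠ β ∧ s.IsOuter α (s.root u) ∧ s.IsOuter β (s.root v) ∧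
    s.IsFoundPath M α β u v p ∧ s' = s.augment α β p

/-- The iteration of Step 2 of `Contract-and-Augment` that reads the arc `a`. -/
def AugmentStep {G : SimpleGraph V} (M : G.Subgraph) (a : V × V) (s' : PhaseState V) : Prop :=
  s.AugmentOp M a.1 a.2 s' ∨ (¬ ∃ s'', s.AugmentOp M a.1 a.2 s'') ∧ s' = s

/-- The working vertex of `α` after backtracking from `W`: the grandparent of `W` in `T'_α` if `W` is
not the root, and `∅` if `W` is the root. -/
def backtrackFrom (α : V) (W : Finset V) : Option (Finset V) :=
  if hW : ∃ Y, W ≠ s.root α ∧ ∃ X, s.TreeArc α Y X ∧ s.TreeArc α X W then some hW.choose else none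

/-- `Backtrack-Stuck-Structures`: every structure that is neither on hold nor modified backtracks. -/
def backtrack : PhaseState V :=
  { s with
    struct := fun α =>
      if α ∈ s.onHold ∨ α ∈ s.modified then s.struct α
      else { s.struct α with working := (s.struct α).working.bind (s.backtrackFrom α) } }

/-- The marking at the beginning of a pass-bundle, with `limit_h = 6 / h + 1`. -/
def mark (h : ℝ) : PhaseState V :=
  { s with
    onHold := {α | 6 / h + 1 ≤ ((s.struct α).verts.card : ℝ)}
    modified := ∅ }

end Views

end PhaseState

/-! ## Passes and phases -/

/-- `L` is a stream of `G`: it presents every arc (ordered adjacent pair) exactly once, in any order. -/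
def IsStream (G : SimpleGraph V) (L : List (V × V)) : Prop :=
  L.Nodup ∧ ∀ a, a ∈ L ↔ G.Adj a.1 a.2

/-- `s'` can result from `s` by one pass over the list `L`, with `step` executed at each arc. -/
inductive Pass (step : PhaseState V → V × V → PhaseState V → Prop) :
    PhaseState V → List (V × V) → PhaseState V → Prop
  | nil (s : PhaseState V) : Pass step s [] s
  | cons {s s' s'' : PhaseState V} {a : V × V} {L : List (V × V)} :
      step s a s' → Pass step s' L s'' → Pass step s (a :: L) s''

/-- `ℓ_max = 3 / ε` (an integer, as `1 / ε` is a power of two). -/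
def labelMax (ε : ℝ) : ℕ := ⌊3 / ε⌋₊

/-- `τ_max(h) = 72 / (h ε)` (an integer, as `1 / ε` and `1 / h` are powers of two). -/
def bundleCount (ε h : ℝ) : ℕ := ⌊72 / (h * ε)⌋₊

/-- `h` is one of the scales `1/2, 1/4, 1/8, …, ε² / 64`. -/
def IsScale (ε h : ℝ) : Prop := ∃ j : ℕ, 1 ≤ j ∧ h = 1 / 2 ^ j ∧ ε ^ 2 / 64 ≤ h

/-- The state at the beginning of a phase. -/
def initial {G : SimpleGraph V} (M : G.Subgraph) (ε : ℝ) : PhaseState V where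
  struct := fun α => if IsFree M α then FreeStructure.single α else FreeStructure.empty V
  label := fun _ => labelMax ε + 1
  removed := ∅
  onHold := ∅
  modified := ∅
  paths := ∅

/-- `s'` can result from `s` by one pass-bundle at scale `h`; every pass may see its own stream order. -/
def PassBundle [Fintype V] {G : SimpleGraph V} (M : G.Subgraph) (h : ℝ) (s s' : PhaseState V) : Prop :=
  ∃ (L₁ L₂ : List (V × V)) (s₁ s₂ s₃ : PhaseState V), IsStream G L₁ ∧ IsStream G L₂ ∧
    Pass (fun r a r' => r.ExtendStep M a r') (s.mark h) L₁ s₁ ∧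
    PhaseState.ContractAll M s₁ s₂ ∧
    Pass (fun r a r' => r.AugmentStep M a r') s₂ L₂ s₃ ∧
    s' = s₃.backtrack

/-- `s` is a possible state after the first `n` pass-bundles of a phase that starts with the matching
`M`, at scale `h`. -/
inductive AfterBundles [Fintype V] {G : SimpleGraph V} (M : G.Subgraph) (ε h : ℝ) :
    ℕ → PhaseState V → Prop
  | start : AfterBundles M ε h 0 (initial M ε)
  | next {n : ℕ} {s s' : PhaseState V} :
      AfterBundles M ε h n s → PassBundle M h s s' → AfterBundles M ε h (n + 1) s'

/-- `s` is a possible state at the end of a phase at scale `h` that starts with the matching `M`. -/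
def IsPhaseEnd [Fintype V] {G : SimpleGraph V} (M : G.Subgraph) (ε h : ℝ) (s : PhaseState V) : Prop :=
  AfterBundles M ε h (bundleCount ε h) s

end

end MatchingPhase

/-! The proof is a potential argument. Call the tree path from the root of a structure to its
working vertex its active path. The potential of a state (`potential`) is three times the sum of the
labels of all matched arcs, plus the number of distinct non-blossom matched arcs lying on active
paths.

Every Contract or Overtake lowers the label sum by at least 1, creates at most one new active arc
and marks at most two structures as modified. The factor 3 pays for all of this, so the potential
plus the number of active modified structures never grows (`progress_of_label_lt`). An Augment only
deletes structures. In a backtracking step, each structure that moves back and stays active drops a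
matched arc from its own active path. Structures are disjoint, so the potential falls by at least
the number of such structures (`Inv.backtrack`).

After a pass-bundle every active structure is on hold, modified, or one that has just moved back.
The last two kinds are paid for by the drop in potential. A structure on hold had at least `6 / h`
matched vertices at the start of the bundle, so with `c` matched arcs there are at most `h * c / 6`
of these (`Inv.card_large_le`). Active sets only shrink, so the final number `N` of active
structures is counted in every bundle. Summation over `72 / (h * ε)` bundles, with initial potential
`3 * c * (labelMax ε + 1) ≤ 12 * c / ε`, gives `N ≤ h * c / 6 + h * c / 6`, and `c ≤ 2 * |M|`
finishes.

Most of the work lies in the invariant `Inv`: structures are disjoint alternating trees over the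
contracted classes, non-blossom matched arcs have positive labels, and labels increase strictly
along active paths. Positivity makes a contraction lower some label. Monotonicity keeps an overtaken
vertex off the overtaker's own active path. The operations are reduced to three moves on abstract
trees: cutting off the subtree of an inner vertex (`cut_rest`, `cut_branch`), grafting it below an
outer vertex (`Live.graft`), and merging the classes on a cycle (`Live.contract`). -/

namespace MatchingPhase
open scoped Classical

variable {V : Type*} {G : SimpleGraph V} {M : G.Subgraph}

/-! ### Alternating trees over contracted classes -/

/-- The parent-child relation between the classes of `R` given by the arcs in `A`. -/
def ClassArc (R : V → Finset V) (A : Finset (V × V)) (X Y : Finset V) : Prop :=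
  X ≠ Y ∧ ∃ a ∈ A, R a.1 = X ∧ R a.2 = Y

/-- The reflexive transitive closure of `ClassArc`. -/
abbrev Anc (R : V → Finset V) (A : Finset (V × V)) : Finset V → Finset V → Prop :=
  Relation.ReflTransGen (ClassArc R A)

/-- `X` is the root class or is entered by a matched arc. -/
def Out (M : G.Subgraph) (R : V → Finset V) (α : V) (A : Finset (V × V)) (X : Finset V) : Prop :=
  X = R α ∨ ∃ x y, (x, y) ∈ A ∧ R x ≠ R y ∧ M.Adj x y ∧ R y = X

/-- Contracting the classes of `R` turns `(S, A)` into an alternating tree rooted at `R α`. -/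
structure AltTree (M : G.Subgraph) (R : V → Finset V) (α : V) (S : Finset V)
    (A : Finset (V × V)) : Prop where
  self : α ∈ S
  free : IsFree M α
  refl : ∀ x, x ∈ R x
  cls : ∀ x ∈ S, ∀ y, R y = R x → y ∈ S
  ends : ∀ x y, (x, y) ∈ A → x ∈ S ∧ y ∈ S
  uniq : ∀ x y x' y', (x, y) ∈ A → (x', y') ∈ A → R x ≠ R y → R x' ≠ R y' → R y = R y' →
    x = x' ∧ y = y'
  top : ∀ x y, (x, y) ∈ A → R x ≠ R y → R y ≠ R α
  reach : ∀ x ∈ S, Anc R A (R α) (R x)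
  mat : ∀ x y, (x, y) ∈ A → R x ≠ R y → M.Adj x y →
    R x = {x} ∧ ∃ p, (p, x) ∈ A ∧ R p ≠ R x ∧ ¬ M.Adj p x
  unm : ∀ x y, (x, y) ∈ A → R x ≠ R y → ¬ M.Adj x y →
    R y = {y} ∧ (∃ t, (y, t) ∈ A ∧ R y ≠ R t ∧ M.Adj y t) ∧ Out M R α A (R x)
  closed : ∀ x ∈ S, ∀ y, M.Adj x y → y ∈ S ∧ (R x = R y ∨ (x, y) ∈ A ∨ (y, x) ∈ A)
  cov : ∀ x ∈ S, x ≠ α → ∃ y, M.Adj x y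

theorem adj_unique (hM : M.IsMatching) {x y z : V} (h : M.Adj x y) (h' : M.Adj x z) : y = z :=
  (hM (M.edge_vert h)).unique h h'

theorem ClassArc.mk {R : V → Finset V} {A : Finset (V × V)} {x y : V} (h : (x, y) ∈ A)
    (hc : R x ≠ R y) : ClassArc R A (R x) (R y) := ⟨hc, (x, y), h, rfl, rfl⟩

theorem ClassArc.exists_arc {R : V → Finset V} {A : Finset (V × V)} {X Y : Finset V}
    (h : ClassArc R A X Y) : ∃ x y, (x, y) ∈ A ∧ R x ≠ R y ∧ R x = X ∧ R y = Y := by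
  obtain ⟨hn, ⟨x, y⟩, ha, rfl, rfl⟩ := h
  exact ⟨x, y, ha, hn, rfl, rfl⟩

theorem ClassArc.anc {R : V → Finset V} {A : Finset (V × V)} {x y : V} (h : (x, y) ∈ A)
    (hc : R x ≠ R y) : Anc R A (R x) (R y) := .single (.mk h hc)

theorem eq_of_trivial {R : V → Finset V} {x y : V} (h : y ∈ R y) (hx : R x = {x})
    (hy : R y = R x) : y = x := by
  rw [hy, hx] at h; simpa using h

theorem Anc.mono {R : V → Finset V} {A B : Finset (V × V)} (h : A ⊆ B) {X Y : Finset V}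
    (hXY : Anc R A X Y) : Anc R B X Y :=
  Relation.ReflTransGen.mono (fun _ _ ⟨hn, a, ha, h1⟩ => ⟨hn, a, h ha, h1⟩) _ _ hXY

namespace AltTree

variable {R : V → Finset V} {α : V} {S : Finset V} {A : Finset (V × V)}

theorem parent_unique (T : AltTree M R α S A) {X Y Z : Finset V} (h : ClassArc R A X Z)
    (h' : ClassArc R A Y Z) : X = Y := by
  obtain ⟨x, z, h1, h2, rfl, rfl⟩ := h.exists_arc
  obtain ⟨y, z', h1', h2', rfl, h3⟩ := h'.exists_arc
  rw [(T.uniq _ _ _ _ h1 h1' h2 h2' h3.symm).1]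

theorem no_parent (T : AltTree M R α S A) {X : Finset V} (h : ClassArc R A X (R α)) : False := by
  obtain ⟨x, z, h1, h2, rfl, h3⟩ := h.exists_arc
  exact T.top _ _ h1 h2 h3

theorem anc_parent (T : AltTree M R α S A) {X Y Z : Finset V} (h : Anc R A Z Y) (hn : Z ≠ Y)
    (h' : ClassArc R A X Y) : Anc R A Z X := by
  rcases Relation.ReflTransGen.cases_tail h with h | ⟨W, h1, h2⟩
  · exact absurd h.symm hn
  · rwa [T.parent_unique h' h2]

theorem eq_root_of_anc (T : AltTree M R α S A) {X : Finset V} (h : Anc R A X (R α)) :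
    X = R α := by
  rcases Relation.ReflTransGen.cases_tail h with h | ⟨W, h1, h2⟩
  · exact h.symm
  · exact (T.no_parent h2).elim

/-- Unique parents alone would allow a cycle away from the root, so the induction runs down the path
from the root: a cycle through a class also passes through its parent, where the induction
hypothesis collapses it. -/
theorem acyclic_aux (T : AltTree M R α S A) {X : Finset V} (h : Anc R A (R α) X) :
    ∀ Y, Anc R A X Y → Anc R A Y X → Y = X := by
  induction h with
  | refl => exact fun Y _ h => T.eq_root_of_anc h
  | @tail P X _ hPX ih =>
    intro Y h1 h2
    by_contra hn
    have h3 := T.anc_parent h2 hn hPX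
    have h4 := ih Y (.head hPX h1) h3
    subst h4
    exact hPX.1 (ih X (.single hPX) h1).symm

theorem acyclic (T : AltTree M R α S A) {x : V} (hx : x ∈ S) {Y : Finset V}
    (h1 : Anc R A (R x) Y) (h2 : Anc R A Y (R x)) : Y = R x :=
  T.acyclic_aux (T.reach x hx) Y h1 h2

/-- Unique parents make the ancestors of a class a chain. -/
theorem comparable (T : AltTree M R α S A) {X Y Z : Finset V} (h1 : Anc R A X Z)
    (h2 : Anc R A Y Z) : Anc R A X Y ∨ Anc R A Y X := by
  induction h1 with
  | refl => exact .inr h2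
  | @tail P Z h3 h4 ih =>
    by_cases hn : Y = Z
    · subst hn; exact .inl (h3.tail h4)
    · exact ih (T.anc_parent h2 hn h4)

theorem mem_of_anc_left (T : AltTree M R α S A) {x y : V} (h : Anc R A (R x) (R y))
    (hy : y ∈ S) : x ∈ S := by
  rcases Relation.ReflTransGen.cases_head h with h | ⟨W, h1, -⟩
  · exact T.cls _ hy _ h
  · obtain ⟨a, b, h1, h2, h3, -⟩ := h1.exists_arc
    exact T.cls _ (T.ends _ _ h1).1 _ h3.symm

theorem mem_of_out (T : AltTree M R α S A) {x : V} (h : Out M R α A (R x)) : x ∈ S := by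
  rcases h with h | ⟨a, b, h1, -, -, h3⟩
  · exact T.cls _ T.self _ h
  · exact T.cls _ (T.ends _ _ h1).2 _ h3.symm

/-- A class entered by an unmatched arc is not outer. -/
theorem not_out (T : AltTree M R α S A) {p v : V} (h : (p, v) ∈ A) (hc : R p ≠ R v)
    (hm : ¬ M.Adj p v) : ¬ Out M R α A (R v) := by
  rintro (h1 | ⟨x, y, h1, h2, h3, h4⟩)
  · exact T.top _ _ h hc h1
  · obtain ⟨rfl, rfl⟩ := T.uniq _ _ _ _ h1 h h2 hc h4
    exact hm h3

/-- A class entered by an unmatched arc has a single child, at the other end of a matched arc. -/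
theorem child_of_inner (T : AltTree M R α S A) (hM : M.IsMatching) {p v t : V} (h : (p, v) ∈ A)
    (hc : R p ≠ R v) (hm : ¬ M.Adj p v) (ht : M.Adj v t) {x y : V} (hxy : (x, y) ∈ A)
    (hn : R x ≠ R y) (hx : R x = R v) : x = v ∧ y = t := by
  have hxv := eq_of_trivial (T.refl x) (T.unm _ _ h hc hm).1 hx
  subst hxv
  refine ⟨rfl, ?_⟩
  by_cases hm' : M.Adj x y
  · exact adj_unique hM hm' ht
  · exact absurd (T.unm _ _ hxy hn hm').2.2 (T.not_out h hc hm)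

theorem arc_of_inner (T : AltTree M R α S A) (hM : M.IsMatching) {p v t : V} (h : (p, v) ∈ A)
    (hc : R p ≠ R v) (hm : ¬ M.Adj p v) (ht : M.Adj v t) : (v, t) ∈ A ∧ R v ≠ R t := by
  obtain ⟨-, ⟨t', h1, h2, h3⟩, -⟩ := T.unm _ _ h hc hm
  obtain rfl := adj_unique hM h3 ht
  exact ⟨h1, h2⟩

theorem anc_child (T : AltTree M R α S A) (hM : M.IsMatching) {p v t : V} (h : (p, v) ∈ A)
    (hc : R p ≠ R v) (hm : ¬ M.Adj p v) (ht : M.Adj v t) {X : Finset V} (hX : Anc R A (R v) X)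
    (hn : X ≠ R v) : Anc R A (R t) X := by
  rcases Relation.ReflTransGen.cases_head hX with h1 | ⟨W, h1, h2⟩
  · exact absurd h1.symm hn
  · obtain ⟨a, b, h3, h4, h5, rfl⟩ := h1.exists_arc
    obtain ⟨-, rfl⟩ := T.child_of_inner hM h hc hm ht h3 h4 h5
    exact h2

/-- Every class of the tree is outer or is entered by an unmatched arc. -/
theorem out_or_inner (T : AltTree M R α S A) {x : V} (hx : x ∈ S) :
    Out M R α A (R x) ∨ ∃ p, (p, x) ∈ A ∧ R p ≠ R x ∧ ¬ M.Adj p x := by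
  rcases Relation.ReflTransGen.cases_tail (T.reach x hx) with h | ⟨W, -, h⟩
  · exact .inl (.inl h)
  · obtain ⟨a, b, h1, h2, -, h3⟩ := h.exists_arc
    by_cases hm : M.Adj a b
    · exact .inl (.inr ⟨a, b, h1, h2, hm, h3⟩)
    · obtain rfl := eq_of_trivial (T.refl x) (T.unm _ _ h1 h2 hm).1 h3.symm
      exact .inr ⟨a, h1, h2, hm⟩

/-- By `mat`, the tail of a matched tree arc is entered by an unmatched arc, hence is inner. -/
theorem not_matched_of_out (T : AltTree M R α S A) {x y : V} (h : (x, y) ∈ A) (hc : R x ≠ R y)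
    (ho : Out M R α A (R x)) : ¬ M.Adj x y := by
  intro hm
  obtain ⟨h1, p, h2, h3, h4⟩ := T.mat _ _ h hc hm
  exact T.not_out h2 h3 h4 ho

/-- A matched edge between different classes whose head class is outer is an arc of the tree. -/
theorem arc_of_crossing (T : AltTree M R α S A) {x y : V} (ho : Out M R α A (R y))
    (hm : M.Adj x y) (hc : R x ≠ R y) : (x, y) ∈ A := by
  obtain ⟨-, h | h | h⟩ := T.closed y (T.mem_of_out ho) x hm.symm
  · exact absurd h.symm hc
  · exact absurd hm.symm (T.not_matched_of_out h hc.symm ho)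
  · exact h

end AltTree

/-! ### Branches rooted at an inner vertex -/

/-- Contracting the classes of `R` turns `(S, A)` into an alternating tree rooted at the inner vertex
`v`, whose only child is reached through the matched arc `(v, t)`. -/
structure Branch (M : G.Subgraph) (R : V → Finset V) (v t : V) (S : Finset V)
    (A : Finset (V × V)) : Prop where
  self : v ∈ S
  triv : R v = {v}
  arc : (v, t) ∈ A
  cross : R v ≠ R t
  adj : M.Adj v t
  refl : ∀ x, x ∈ R x
  cls : ∀ x ∈ S, ∀ y, R y = R x → y ∈ S
  ends : ∀ x y, (x, y) ∈ A → x ∈ S ∧ y ∈ S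
  uniq : ∀ x y x' y', (x, y) ∈ A → (x', y') ∈ A → R x ≠ R y → R x' ≠ R y' → R y = R y' →
    x = x' ∧ y = y'
  top : ∀ x y, (x, y) ∈ A → R x ≠ R y → R y ≠ R v
  reach : ∀ x ∈ S, Anc R A (R v) (R x)
  mat : ∀ x y, (x, y) ∈ A → R x ≠ R y → M.Adj x y →
    R x = {x} ∧ (x = v ∨ ∃ p, (p, x) ∈ A ∧ R p ≠ R x ∧ ¬ M.Adj p x)
  unm : ∀ x y, (x, y) ∈ A → R x ≠ R y → ¬ M.Adj x y →
    R y = {y} ∧ (∃ t, (y, t) ∈ A ∧ R y ≠ R t ∧ M.Adj y t) ∧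
      ∃ x' y', (x', y') ∈ A ∧ R x' ≠ R y' ∧ M.Adj x' y' ∧ R y' = R x
  closed : ∀ x ∈ S, ∀ y, M.Adj x y → y ∈ S ∧ (R x = R y ∨ (x, y) ∈ A ∨ (y, x) ∈ A)
  cov : ∀ x ∈ S, ∃ y, M.Adj x y

namespace Branch

variable {R : V → Finset V} {v t : V} {S : Finset V} {A : Finset (V × V)}

theorem eq_root_of_anc (B : Branch M R v t S A) {X : Finset V} (h : Anc R A X (R v)) :
    X = R v := by
  rcases Relation.ReflTransGen.cases_tail h with h | ⟨W, h1, h2⟩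
  · exact h.symm
  · obtain ⟨x, z, h3, h4, -, h5⟩ := h2.exists_arc
    exact (B.top _ _ h3 h4 h5).elim

/-- An unmatched arc can only leave a class entered by a matched arc, and the root of a branch is
entered by nothing. -/
theorem arc_from_root (B : Branch M R v t S A) (hM : M.IsMatching) {x y : V} (h : (x, y) ∈ A)
    (hn : R x ≠ R y) (hx : R x = R v) : x = v ∧ y = t := by
  have hxv := eq_of_trivial (B.refl x) B.triv hx
  subst hxv
  refine ⟨rfl, ?_⟩
  by_cases hm : M.Adj x y
  · exact adj_unique hM hm B.adj
  · obtain ⟨x', y', h1, h2, -, h3⟩ := (B.unm _ _ h hn hm).2.2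
    exact absurd h3 (B.top _ _ h1 h2)

theorem anc_child (B : Branch M R v t S A) (hM : M.IsMatching) {x : V} (hx : x ∈ S)
    (hn : R x ≠ R v) : Anc R A (R t) (R x) := by
  rcases Relation.ReflTransGen.cases_head (B.reach x hx) with h1 | ⟨W, h1, h2⟩
  · exact absurd h1.symm hn
  · obtain ⟨a, b, h3, h4, h5, rfl⟩ := h1.exists_arc
    obtain ⟨-, rfl⟩ := B.arc_from_root hM h3 h4 h5
    exact h2

/-- The class of `t` is a child of the root, so it is the only one of its ancestors that is entered
by an arc. -/
theorem eq_arc_of_anc (B : Branch M R v t S A) {x y : V} (h : (x, y) ∈ A)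
    (hn : R x ≠ R y) (hy : Anc R A (R y) (R t)) : x = v ∧ y = t := by
  rcases Relation.ReflTransGen.cases_tail hy with h1 | ⟨W, h1, h2⟩
  · exact B.uniq _ _ _ _ h B.arc hn B.cross h1.symm
  · obtain ⟨a, b, h3, h4, rfl, h5⟩ := h2.exists_arc
    obtain ⟨rfl, rfl⟩ := B.uniq _ _ _ _ h3 B.arc h4 B.cross h5
    exact absurd (B.eq_root_of_anc h1) (B.top _ _ h hn)

/-- The one-arc branch grafted when Overtake claims a matched arc that no structure contains. -/
theorem pair {R : V → Finset V} {v t : V} (refl : ∀ x, x ∈ R x) (hv : R v = {v}) (ht : R t = {t})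
    (h : M.Adj v t) (hM : M.IsMatching) {S : Finset V} {A : Finset (V × V)}
    (hS : ∀ x, x ∈ S ↔ x = v ∨ x = t) (hA : ∀ a, a ∈ A ↔ a = (v, t)) :
    Branch M R v t S A := by
  have hn : R v ≠ R t := by
    rw [hv, ht]; intro h1; exact (G.ne_of_adj (M.adj_sub h)) (by simpa using h1)
  have hA' : ∀ x y, (x, y) ∈ A ↔ x = v ∧ y = t := fun x y => by rw [hA, Prod.mk.injEq]
  have harc : (v, t) ∈ A := (hA' _ _).2 ⟨rfl, rfl⟩
  refine ⟨by simp [hS], hv, harc, hn, h, refl, ?_, ?_, ?_, ?_, ?_, ?_, ?_, ?_, ?_⟩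
  · intro x hx y hy
    rw [hS] at hx ⊢
    rcases hx with rfl | rfl
    · exact .inl (eq_of_trivial (refl y) hv hy)
    · exact .inr (eq_of_trivial (refl y) ht hy)
  · intro x y hxy
    obtain ⟨rfl, rfl⟩ := (hA' _ _).1 hxy
    simp [hS]
  · intro x y x' y' h1 h2 _ _ _
    obtain ⟨rfl, rfl⟩ := (hA' _ _).1 h1
    obtain ⟨rfl, rfl⟩ := (hA' _ _).1 h2
    exact ⟨rfl, rfl⟩
  · intro x y h1 _
    obtain ⟨rfl, rfl⟩ := (hA' _ _).1 h1
    exact hn.symm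
  · intro x hx
    rcases (hS x).1 hx with rfl | rfl
    · exact .refl
    · exact ClassArc.anc harc hn
  · intro x y h1 _ _
    obtain ⟨rfl, rfl⟩ := (hA' _ _).1 h1
    exact ⟨hv, .inl rfl⟩
  · intro x y h1 _ h2
    obtain ⟨rfl, rfl⟩ := (hA' _ _).1 h1
    exact absurd h h2
  · intro x hx y hxy
    rcases (hS x).1 hx with rfl | rfl
    · obtain rfl := adj_unique hM hxy h
      exact ⟨by simp [hS], .inr (.inl harc)⟩
    · obtain rfl := adj_unique hM hxy h.symm
      exact ⟨by simp [hS], .inr (.inr harc)⟩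
  · intro x hx
    rcases (hS x).1 hx with rfl | rfl
    exacts [⟨_, h⟩, ⟨_, h.symm⟩]

end Branch

theorem Anc.head_of_tail {R : V → Finset V} {A : Finset (V × V)} {X : Finset V} {x y : V}
    (h : (x, y) ∈ A) (hx : Anc R A X (R x)) : Anc R A X (R y) := by
  by_cases hc : R x = R y
  · rwa [← hc]
  · exact hx.tail (.mk h hc)

namespace AltTree

/-! ### Cutting a tree at an inner vertex -/

section Cut

variable {R : V → Finset V} {α p v t : V} {S S' : Finset V} {A A' : Finset (V × V)}

/-- The arc `(p, v)` is the only entrance to the subtree of `v`, because heads determine arcs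
between classes. -/
theorem tail_below (T : AltTree M R α S A) (h : (p, v) ∈ A) (hc : R p ≠ R v) {x y : V}
    (hxy : (x, y) ∈ A) (hy : Anc R A (R v) (R y)) (hn : (x, y) ≠ (p, v)) :
    Anc R A (R v) (R x) := by
  by_cases hxy' : R x = R y
  · rwa [hxy']
  · by_cases hyv : R v = R y
    · obtain ⟨rfl, rfl⟩ := T.uniq _ _ _ _ hxy h hxy' hc hyv.symm
      exact absurd rfl hn
    · exact T.anc_parent hy hyv (.mk hxy hxy')

theorem not_below_parent (T : AltTree M R α S A) (h : (p, v) ∈ A) (hc : R p ≠ R v) :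
    ¬ Anc R A (R v) (R p) := fun h' =>
  hc (T.acyclic (T.ends _ _ h).2 h' (ClassArc.anc h hc))

/-- Cutting off the subtree of an inner vertex leaves a tree. -/
theorem cut_rest (T : AltTree M R α S A) (h : (p, v) ∈ A) (hc : R p ≠ R v)
    (hm : ¬ M.Adj p v) (hS : ∀ x, x ∈ S' ↔ x ∈ S ∧ ¬ Anc R A (R v) (R x))
    (hA : ∀ x y, (x, y) ∈ A' ↔ (x, y) ∈ A ∧ ¬ Anc R A (R v) (R y)) :
    AltTree M R α S' A' := by
  have hsub : A' ⊆ A := fun a ha => ((hA a.1 a.2).1 ha).1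
  have hkeep : ∀ x y, (x, y) ∈ A → ¬ Anc R A (R v) (R x) → (x, y) ≠ (p, v) → (x, y) ∈ A' :=
    fun x y h1 h2 h3 => (hA _ _).2 ⟨h1, fun h4 => h2 (T.tail_below h hc h1 h4 h3)⟩
  have htail : ∀ x y, (x, y) ∈ A' → ¬ Anc R A (R v) (R x) := fun x y h1 h2 =>
    ((hA _ _).1 h1).2 (Anc.head_of_tail (hsub h1) h2)
  refine ⟨?_, T.free, T.refl, ?_, ?_, ?_, ?_, ?_, ?_, ?_, ?_, ?_⟩
  · exact (hS _).2 ⟨T.self, fun h' => T.top _ _ h hc (T.eq_root_of_anc h')⟩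
  · intro x hx y hy
    rw [hS] at hx ⊢
    exact ⟨T.cls x hx.1 y hy, hy ▸ hx.2⟩
  · intro x y hxy
    have h1 := T.ends _ _ (hsub hxy)
    exact ⟨(hS _).2 ⟨h1.1, htail _ _ hxy⟩, (hS _).2 ⟨h1.2, ((hA _ _).1 hxy).2⟩⟩
  · intro x y x' y' h1 h2
    exact T.uniq _ _ _ _ (hsub h1) (hsub h2)
  · intro x y h1
    exact T.top _ _ (hsub h1)
  · intro x hx
    rw [hS] at hx
    obtain ⟨hx, hv⟩ := hx
    have := T.reach x hx
    generalize R x = X at *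
    induction this with
    | refl => exact .refl
    | @tail Y Z _ h2 ih =>
      obtain ⟨y, z, h3, h4, rfl, rfl⟩ := h2.exists_arc
      exact (ih fun h5 => hv (h5.tail h2)).tail (.mk ((hA _ _).2 ⟨h3, hv⟩) h4)
  · intro x y hxy hn hm'
    obtain ⟨h1, q, h2, h3, h4⟩ := T.mat _ _ (hsub hxy) hn hm'
    exact ⟨h1, q, (hA _ _).2 ⟨h2, htail _ _ hxy⟩, h3, h4⟩
  · intro x y hxy hn hm'
    obtain ⟨h1, ⟨t, h2, h3, h4⟩, h5⟩ := T.unm _ _ (hsub hxy) hn hm'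
    refine ⟨h1, ⟨t, hkeep _ _ h2 ((hA _ _).1 hxy).2 ?_, h3, h4⟩, ?_⟩
    · rintro ⟨⟩; exact hm h4
    · rcases h5 with h5 | ⟨a, b, h5, h6, h7, h8⟩
      · exact .inl h5
      · exact .inr ⟨a, b, (hA _ _).2 ⟨h5, h8 ▸ htail _ _ hxy⟩, h6, h7, h8⟩
  · intro x hx y hxy
    rw [hS] at hx
    obtain ⟨h1, h2⟩ := T.closed x hx.1 y hxy
    rcases h2 with h2 | h2 | h2
    · exact ⟨(hS _).2 ⟨h1, h2 ▸ hx.2⟩, .inl h2⟩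
    · have h3 : (x, y) ∈ A' := hkeep _ _ h2 hx.2 (by rintro ⟨⟩; exact hm hxy)
      exact ⟨(hS _).2 ⟨h1, ((hA _ _).1 h3).2⟩, .inr (.inl h3)⟩
    · have h3 : (y, x) ∈ A' := (hA _ _).2 ⟨h2, hx.2⟩
      exact ⟨(hS _).2 ⟨h1, htail _ _ h3⟩, .inr (.inr h3)⟩
  · intro x hx
    exact T.cov x ((hS _).1 hx).1

/-- The subtree of an inner vertex. -/
theorem cut_branch (T : AltTree M R α S A) (hM : M.IsMatching) (h : (p, v) ∈ A)
    (hc : R p ≠ R v) (hm : ¬ M.Adj p v) (ht : M.Adj v t)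
    (hS : ∀ x, x ∈ S' ↔ x ∈ S ∧ Anc R A (R v) (R x))
    (hA : ∀ x y, (x, y) ∈ A' ↔ (x, y) ∈ A ∧ Anc R A (R v) (R x)) :
    Branch M R v t S' A' := by
  have hsub : A' ⊆ A := fun a ha => ((hA a.1 a.2).1 ha).1
  obtain ⟨hvt, hvt'⟩ := T.arc_of_inner hM h hc hm ht
  have hkeep : ∀ x y, (x, y) ∈ A → Anc R A (R v) (R y) → (x, y) ≠ (p, v) → (x, y) ∈ A' :=
    fun x y h1 h2 h3 => (hA _ _).2 ⟨h1, T.tail_below h hc h1 h2 h3⟩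
  have hhead : ∀ x y, (x, y) ∈ A' → Anc R A (R v) (R y) := fun x y h1 =>
    Anc.head_of_tail (hsub h1) ((hA _ _).1 h1).2
  have hp : ∀ y, (p, y) ∉ A' := fun y h1 =>
    T.not_below_parent h hc ((hA _ _).1 h1).2
  refine ⟨(hS _).2 ⟨(T.ends _ _ h).2, .refl⟩, (T.unm _ _ h hc hm).1, (hA _ _).2 ⟨hvt, .refl⟩,
    hvt', ht, T.refl, ?_, ?_, ?_, ?_, ?_, ?_, ?_, ?_, ?_⟩
  · intro x hx y hy
    rw [hS] at hx ⊢
    exact ⟨T.cls x hx.1 y hy, hy ▸ hx.2⟩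
  · intro x y hxy
    have h1 := T.ends _ _ (hsub hxy)
    exact ⟨(hS _).2 ⟨h1.1, ((hA _ _).1 hxy).2⟩, (hS _).2 ⟨h1.2, hhead _ _ hxy⟩⟩
  · intro x y x' y' h1 h2
    exact T.uniq _ _ _ _ (hsub h1) (hsub h2)
  · intro x y h1 h2 h3
    obtain ⟨rfl, rfl⟩ := T.uniq _ _ _ _ (hsub h1) h h2 hc h3
    exact hp _ h1
  · intro x hx
    have := ((hS _).1 hx).2
    generalize R x = X at *
    induction this with
    | refl => exact .refl
    | @tail Y Z h1 h2 ih =>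
      obtain ⟨y, z, h3, h4, rfl, rfl⟩ := h2.exists_arc
      exact ih.tail (.mk ((hA _ _).2 ⟨h3, h1⟩) h4)
  · intro x y hxy hn hm'
    obtain ⟨h1, q, h2, h3, h4⟩ := T.mat _ _ (hsub hxy) hn hm'
    refine ⟨h1, ?_⟩
    by_cases hxv : x = v
    · exact .inl hxv
    · exact .inr ⟨q, hkeep _ _ h2 ((hA _ _).1 hxy).2 (fun h5 => hxv (Prod.mk.inj h5).2), h3, h4⟩
  · intro x y hxy hn hm'
    obtain ⟨h1, ⟨t, h2, h3, h4⟩, h5⟩ := T.unm _ _ (hsub hxy) hn hm'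
    refine ⟨h1, ⟨t, (hA _ _).2 ⟨h2, hhead _ _ hxy⟩, h3, h4⟩, ?_⟩
    have hvx := ((hA _ _).1 hxy).2
    rcases h5 with h5 | ⟨a, b, h5, h6, h7, h8⟩
    · exact absurd (T.eq_root_of_anc (h5 ▸ hvx)) (T.top _ _ h hc)
    · refine ⟨a, b, hkeep _ _ h5 (h8 ▸ hvx) ?_, h6, h7, h8⟩
      rintro ⟨⟩; exact hm h7
  · intro x hx y hxy
    rw [hS] at hx
    obtain ⟨h1, h2⟩ := T.closed x hx.1 y hxy
    rcases h2 with h2 | h2 | h2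
    · exact ⟨(hS _).2 ⟨h1, h2 ▸ hx.2⟩, .inl h2⟩
    · have h3 : (x, y) ∈ A' := (hA _ _).2 ⟨h2, hx.2⟩
      exact ⟨(hS _).2 ⟨h1, hhead _ _ h3⟩, .inr (.inl h3)⟩
    · have h3 : (y, x) ∈ A' := hkeep _ _ h2 hx.2 (by rintro ⟨⟩; exact hm hxy.symm)
      exact ⟨(hS _).2 ⟨h1, ((hA _ _).1 h3).2⟩, .inr (.inr h3)⟩
  · intro x hx
    rw [hS] at hx
    refine T.cov x hx.1 ?_
    rintro rfl
    exact T.top _ _ h hc (T.eq_root_of_anc hx.2)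

end Cut

/-! ### Grafting a branch below an outer vertex -/

section Graft

variable {R : V → Finset V} {α u v t : V} {S S₁ S' : Finset V} {A A₁ A' : Finset (V × V)}

/-- Hanging a branch below an outer class gives a tree. -/
theorem graft (T : AltTree M R α S A) (B : Branch M R v t S₁ A₁) (hd : ∀ x ∈ S, x ∉ S₁)
    (hu : Out M R α A (R u)) (huv : ¬ M.Adj u v)
    (hS : ∀ x, x ∈ S' ↔ x ∈ S ∨ x ∈ S₁)
    (hA : ∀ x y, (x, y) ∈ A' ↔ (x, y) ∈ A ∨ (x, y) ∈ A₁ ∨ (x = u ∧ y = v)) :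
    AltTree M R α S' A' := by
  have huS := T.mem_of_out hu
  have hne : ∀ x ∈ S, ∀ y ∈ S₁, R x ≠ R y := fun x hx y hy h => hd x hx (B.cls y hy x h)
  have hsub : A ⊆ A' := fun a ha => (hA a.1 a.2).2 (.inl ha)
  have hsub₁ : A₁ ⊆ A' := fun a ha => (hA a.1 a.2).2 (.inr (.inl ha))
  have huv' : (u, v) ∈ A' := (hA _ _).2 (.inr (.inr ⟨rfl, rfl⟩))
  have huvc := hne u huS v B.self
  refine ⟨(hS _).2 (.inl T.self), T.free, T.refl, ?_, ?_, ?_, ?_, ?_, ?_, ?_, ?_, ?_⟩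
  · intro x hx y hy
    rw [hS] at hx ⊢
    exact hx.imp (T.cls x · y hy) (B.cls x · y hy)
  · intro x y hxy
    simp only [hS]
    rcases (hA _ _).1 hxy with h | h | ⟨rfl, rfl⟩
    · exact (T.ends _ _ h).imp .inl .inl
    · exact (B.ends _ _ h).imp .inr .inr
    · exact ⟨.inl huS, .inr B.self⟩
  · intro x y x' y' h1 h2 h3 h4 h5
    rcases (hA _ _).1 h1 with h | h | ⟨rfl, rfl⟩ <;> rcases (hA _ _).1 h2 with h' | h' | ⟨rfl, rfl⟩
    · exact T.uniq _ _ _ _ h h' h3 h4 h5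
    · exact absurd h5 (hne _ (T.ends _ _ h).2 _ (B.ends _ _ h').2)
    · exact absurd h5 (hne _ (T.ends _ _ h).2 _ B.self)
    · exact absurd h5.symm (hne _ (T.ends _ _ h').2 _ (B.ends _ _ h).2)
    · exact B.uniq _ _ _ _ h h' h3 h4 h5
    · exact absurd h5 (B.top _ _ h h3)
    · exact absurd h5.symm (hne _ (T.ends _ _ h').2 _ B.self)
    · exact absurd h5.symm (B.top _ _ h' h4)
    · exact ⟨rfl, rfl⟩
  · intro x y h1 h2
    rcases (hA _ _).1 h1 with h | h | ⟨rfl, rfl⟩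
    · exact T.top _ _ h h2
    · exact (hne _ T.self _ (B.ends _ _ h).2).symm
    · exact (hne _ T.self _ B.self).symm
  · intro x hx
    rcases (hS _).1 hx with hx | hx
    · exact (T.reach x hx).mono hsub
    · exact (((T.reach u huS).mono hsub).tail (.mk huv' huvc)).trans
        ((B.reach x hx).mono hsub₁)
  · intro x y h1 h2 h3
    rcases (hA _ _).1 h1 with h | h | ⟨rfl, rfl⟩
    · obtain ⟨h4, p, h5, h6⟩ := T.mat _ _ h h2 h3
      exact ⟨h4, p, hsub h5, h6⟩
    · obtain ⟨h4, rfl | ⟨p, h5, h6⟩⟩ := B.mat _ _ h h2 h3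
      · exact ⟨h4, u, huv', huvc, huv⟩
      · exact ⟨h4, p, hsub₁ h5, h6⟩
    · exact absurd h3 huv
  · have hout : ∀ X, Out M R α A X → Out M R α A' X := fun X h =>
      h.imp id fun ⟨x, y, h1, h2⟩ => ⟨x, y, hsub h1, h2⟩
    intro x y h1 h2 h3
    rcases (hA _ _).1 h1 with h | h | ⟨rfl, rfl⟩
    · obtain ⟨h4, ⟨t, h5, h6⟩, h7⟩ := T.unm _ _ h h2 h3
      exact ⟨h4, ⟨t, hsub h5, h6⟩, hout _ h7⟩
    · obtain ⟨h4, ⟨t, h5, h6⟩, a, b, h7, h8⟩ := B.unm _ _ h h2 h3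
      exact ⟨h4, ⟨t, hsub₁ h5, h6⟩, .inr ⟨a, b, hsub₁ h7, h8⟩⟩
    · exact ⟨B.triv, ⟨t, hsub₁ B.arc, B.cross, B.adj⟩, hout _ hu⟩
  · intro x hx y hxy
    simp only [hS]
    rcases (hS _).1 hx with hx | hx
    · exact (T.closed x hx y hxy).imp .inl
        (.imp id (.imp (hsub ·) (hsub ·)))
    · exact (B.closed x hx y hxy).imp .inr
        (.imp id (.imp (hsub₁ ·) (hsub₁ ·)))
  · intro x hx hn
    rcases (hS _).1 hx with hx | hx
    exacts [T.cov x hx hn, B.cov x hx]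

/-- No arc leads from the branch back into the old tree, so old classes gain no ancestors. -/
theorem graft_anc_old (T : AltTree M R α S A) (B : Branch M R v t S₁ A₁)
    (hd : ∀ x ∈ S, x ∉ S₁)
    (hA : ∀ x y, (x, y) ∈ A' ↔ (x, y) ∈ A ∨ (x, y) ∈ A₁ ∨ (x = u ∧ y = v)) {Z : Finset V} {x : V}
    (hx : x ∈ S) (h : Anc R A' Z (R x)) : Anc R A Z (R x) := by
  have hne : ∀ x ∈ S, ∀ y ∈ S₁, R x ≠ R y := fun x hx y hy h => hd x hx (B.cls y hy x h)
  generalize hX : R x = X at h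
  induction h generalizing x with
  | refl => exact .refl
  | tail h1 h2 ih =>
    obtain ⟨a, b, h3, h4, rfl, rfl⟩ := h2.exists_arc
    rcases (hA _ _).1 h3 with h | h | ⟨rfl, rfl⟩
    · exact (ih (T.ends _ _ h).1 rfl).tail (.mk h h4)
    · exact absurd hX (hne _ hx _ (B.ends _ _ h).2)
    · exact absurd hX (hne _ hx _ B.self)

theorem graft_anc_branch (T : AltTree M R α S A) (B : Branch M R v t S₁ A₁)
    (hd : ∀ x ∈ S, x ∉ S₁) (hu : u ∈ S)
    (hA : ∀ x y, (x, y) ∈ A' ↔ (x, y) ∈ A ∨ (x, y) ∈ A₁ ∨ (x = u ∧ y = v)) {Z : Finset V} {x : V}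
    (hx : x ∈ S₁) (h : Anc R A' (R x) Z) : Anc R A₁ (R x) Z := by
  have hne : ∀ x ∈ S, ∀ y ∈ S₁, R x ≠ R y := fun x hx y hy h => hd x hx (B.cls y hy x h)
  generalize hX : R x = X at h
  induction h using Relation.ReflTransGen.head_induction_on generalizing x with
  | refl => exact .refl
  | head h1 h2 ih =>
    obtain ⟨a, b, h3, h4, rfl, rfl⟩ := h1.exists_arc
    rcases (hA _ _).1 h3 with h | h | ⟨rfl, rfl⟩
    · exact absurd hX.symm (hne _ (T.ends _ _ h).1 _ hx)
    · exact .head (.mk h h4) (ih (B.ends _ _ h).2 rfl)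
    · exact absurd hX.symm (hne _ hu _ hx)

/-- The new arc `(u, v)` is the only passage from the old tree into the branch. -/
theorem graft_anc_cross (T : AltTree M R α S A) (B : Branch M R v t S₁ A₁)
    (hd : ∀ x ∈ S, x ∉ S₁) (hu : u ∈ S)
    (hA : ∀ x y, (x, y) ∈ A' ↔ (x, y) ∈ A ∨ (x, y) ∈ A₁ ∨ (x = u ∧ y = v)) {x y : V}
    (hx : x ∈ S) (hy : y ∈ S₁) (h : Anc R A' (R x) (R y)) : Anc R A (R x) (R u) := by
  have hne : ∀ x ∈ S, ∀ y ∈ S₁, R x ≠ R y := fun x hx y hy h => hd x hx (B.cls y hy x h)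
  generalize hX : R y = X at h
  induction h generalizing y with
  | refl => exact absurd hX.symm (hne _ hx _ hy)
  | tail h1 h2 ih =>
    obtain ⟨a, b, h3, h4, rfl, rfl⟩ := h2.exists_arc
    rcases (hA _ _).1 h3 with h | h | ⟨rfl, rfl⟩
    · exact absurd hX.symm (hne _ (T.ends _ _ h).2 _ hy)
    · exact ih (B.ends _ _ h).1 rfl
    · exact T.graft_anc_old B hd hA hu h1

end Graft

end AltTree

/-! ### Labels along active paths -/

/-- The structure `st` of `α` is an alternating tree whose working vertex is outer and whose labels
increase along the path from the root to the working vertex. -/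
structure Live (M : G.Subgraph) (R : V → Finset V) (ℓ : V × V → ℕ) (α : V)
    (st : FreeStructure V) : Prop where
  tree : AltTree M R α st.verts st.arcs
  pos : ∀ x y, (x, y) ∈ st.arcs → R x ≠ R y → M.Adj x y → 0 < ℓ (x, y)
  out : ∀ W, st.working = some W → Out M R α st.arcs W
  incr : ∀ W, st.working = some W → ∀ x y x' y', (x, y) ∈ st.arcs → (x', y') ∈ st.arcs →
    R x ≠ R y → R x' ≠ R y' → M.Adj x y → M.Adj x' y' → Anc R st.arcs (R y) (R x') →
    Anc R st.arcs (R y') W → ℓ (x, y) < ℓ (x', y')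

/-- `a` is a matched arc on the path from the root of the tree to the working vertex. -/
def OnPath (M : G.Subgraph) (R : V → Finset V) (st : FreeStructure V) (a : V × V) : Prop :=
  ∃ W, st.working = some W ∧ a ∈ st.arcs ∧ R a.1 ≠ R a.2 ∧ M.Adj a.1 a.2 ∧
    Anc R st.arcs (R a.2) W

theorem AltTree.cut_out {R : V → Finset V} {α v : V} {A A' : Finset (V × V)} {X : Finset V}
    (hA : ∀ x y, (x, y) ∈ A' ↔ (x, y) ∈ A ∧ ¬ Anc R A (R v) (R y)) (h : Out M R α A X)
    (hX : ¬ Anc R A (R v) X) : Out M R α A' X := by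
  rcases h with h | ⟨x, y, h1, h2, h3, rfl⟩
  · exact .inl h
  · exact .inr ⟨x, y, (hA _ _).2 ⟨h1, hX⟩, h2, h3, rfl⟩

namespace Live

variable {R : V → Finset V} {ℓ ℓ' : V × V → ℕ} {α : V} {st st' : FreeStructure V}

/-- Shrinking the tree and moving the working vertex towards the root. -/
theorem shrink (L : Live M R ℓ α st) (T : AltTree M R α st'.verts st'.arcs)
    (hA : st'.arcs ⊆ st.arcs) (hℓ : ∀ a ∈ st'.arcs, ℓ' a = ℓ a)
    (hW : ∀ W', st'.working = some W' → Out M R α st'.arcs W' ∧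
      ∃ W, st.working = some W ∧ Anc R st.arcs W' W) :
    Live M R ℓ' α st' ∧ ∀ a, OnPath M R st' a → OnPath M R st a := by
  refine ⟨⟨T, ?_, fun W' h => (hW W' h).1, ?_⟩, ?_⟩
  · intro x y h1
    rw [hℓ _ h1]
    exact L.pos _ _ (hA h1)
  · intro W' h x y x' y' h1 h2 h3 h4 h5 h6 h7 h8
    obtain ⟨-, W, hW, hW'⟩ := hW W' h
    rw [hℓ _ h1, hℓ _ h2]
    exact L.incr W hW _ _ _ _ (hA h1) (hA h2) h3 h4 h5 h6 (h7.mono hA) ((h8.mono hA).trans hW')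
  · rintro a ⟨W', h1, h2, h3, h4, h5⟩
    obtain ⟨-, W, hW, hW'⟩ := hW W' h1
    exact ⟨W, hW, hA h2, h3, h4, (h5.mono hA).trans hW'⟩

section Graft

variable {u v t w : V} {d : ℕ} {S₁ : Finset V} {A₁ : Finset (V × V)}

/-- The new active path is the old one up to `u`, then `(v, t)`, then a path inside the branch.
Labels increase along it because those on the old part are at most `d`, the new label of `(v, t)` is
`d + 1`, and those further down exceed the old label of `(v, t)`, which was larger still. -/
theorem graft (L : Live M R ℓ α st) (hM : M.IsMatching) (B : Branch M R v t S₁ A₁)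
    (hd : ∀ x ∈ st.verts, x ∉ S₁) (hu : st.working = some (R u)) (huv : ¬ M.Adj u v)
    (hdist : ∀ a, OnPath M R st a → ℓ a ≤ d) (hvt : d + 1 < ℓ (v, t))
    (hpos : ∀ x y, (x, y) ∈ A₁ → R x ≠ R y → M.Adj x y → 0 < ℓ (x, y))
    (hS : ∀ x, x ∈ st'.verts ↔ x ∈ st.verts ∨ x ∈ S₁)
    (hA : ∀ x y, (x, y) ∈ st'.arcs ↔ (x, y) ∈ st.arcs ∨ (x, y) ∈ A₁ ∨ (x = u ∧ y = v))
    (hℓ : ℓ' (v, t) = d + 1) (hℓ' : ∀ a, a ≠ (v, t) → ℓ' a = ℓ a)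
    (hW : st'.working = some (R w)) (hw : w ∈ S₁)
    (hout : ∃ x y, (x, y) ∈ A₁ ∧ R x ≠ R y ∧ M.Adj x y ∧ R y = R w)
    (hincr : ∀ x y x' y', (x, y) ∈ A₁ → (x', y') ∈ A₁ → R x ≠ R y → R x' ≠ R y' → M.Adj x y →
      M.Adj x' y' → Anc R A₁ (R y) (R x') → Anc R A₁ (R y') (R w) → ℓ (x, y) < ℓ (x', y')) :
    Live M R ℓ' α st' ∧ ∀ a, OnPath M R st' a →
      OnPath M R st a ∨ a ∈ A₁ ∧ R a.1 ≠ R a.2 ∧ M.Adj a.1 a.2 ∧ Anc R A₁ (R a.2) (R w) := by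
  have T := L.tree
  have hne : ∀ x ∈ st.verts, ∀ y ∈ S₁, R x ≠ R y := fun x hx y hy h => hd x hx (B.cls y hy x h)
  have huO := L.out _ hu
  have huS := T.mem_of_out huO
  have hℓold : ∀ x y, (x, y) ∈ st.arcs → ℓ' (x, y) = ℓ (x, y) := fun x y h => hℓ' _ (by
    rintro ⟨⟩; exact hd _ (T.ends _ _ h).1 B.self)
  have hold := fun {Z x} => T.graft_anc_old (u := u) (Z := Z) (x := x) B hd hA
  have hbr := fun {Z x} => T.graft_anc_branch (Z := Z) (x := x) B hd huS hA
  have hcr := fun {x y} => T.graft_anc_cross (x := x) (y := y) B hd huS hA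
  have hpath : ∀ a, OnPath M R st' a →
      OnPath M R st a ∨ a ∈ A₁ ∧ R a.1 ≠ R a.2 ∧ M.Adj a.1 a.2 ∧ Anc R A₁ (R a.2) (R w) := by
    rintro ⟨x, y⟩ ⟨W, h1, h2, h3, h4, h5⟩
    obtain rfl : R w = W := by simpa [hW] using h1
    rcases (hA _ _).1 h2 with h | h | ⟨rfl, rfl⟩
    · exact .inl ⟨_, hu, h, h3, h4, hcr (T.ends _ _ h).2 hw h5⟩
    · exact .inr ⟨h, h3, h4, hbr (B.ends _ _ h).2 h5⟩
    · exact absurd h4 huv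
  refine ⟨⟨T.graft B hd huO huv hS hA, ?_, ?_, ?_⟩, hpath⟩
  · intro x y h1 h2 h3
    by_cases hxy : (x, y) = (v, t)
    · rw [hxy, hℓ]; omega
    · rw [hℓ' _ hxy]
      rcases (hA _ _).1 h1 with h | h | ⟨rfl, rfl⟩
      · exact L.pos _ _ h h2 h3
      · exact hpos _ _ h h2 h3
      · exact absurd h3 huv
  · intro W h
    obtain rfl : R w = W := by simpa [hW] using h
    obtain ⟨x, y, h1, h2⟩ := hout
    exact .inr ⟨x, y, (hA _ _).2 (.inr (.inl h1)), h2⟩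
  · intro W h x y x' y' h1 h2 h3 h4 h5 h6 h7 h8
    obtain rfl : R w = W := by simpa [hW] using h
    rcases (hA _ _).1 h2 with h2 | h2 | ⟨rfl, rfl⟩
    · have h9 := hold (T.ends _ _ h2).1 h7
      have h10 := T.mem_of_anc_left h9 (T.ends _ _ h2).1
      have h11 : (x, y) ∈ st.arcs := by
        rcases (hA _ _).1 h1 with h | h | ⟨rfl, rfl⟩
        · exact h
        · exact absurd (B.ends _ _ h).2 (hd _ h10)
        · exact absurd B.self (hd _ h10)
      rw [hℓold _ _ h11, hℓold _ _ h2]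
      exact L.incr _ hu _ _ _ _ h11 h2 h3 h4 h5 h6 h9 (hcr (T.ends _ _ h2).2 hw h8)
    · have h9 := hbr (B.ends _ _ h2).2 h8
      -- Every later matched arc on the path lies below `(v, t)`, so monotonicity inside the branch
      -- bounds it by the old label of `(v, t)`.
      have hlt : (x', y') ≠ (v, t) → ℓ (v, t) < ℓ (x', y') := fun hn => by
        refine hincr _ _ _ _ B.arc h2 B.cross h4 B.adj h6 (B.anc_child hM (B.ends _ _ h2).1 ?_) h9
        intro h10
        obtain ⟨rfl, rfl⟩ := B.arc_from_root hM h2 h4 h10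
        exact hn rfl
      rcases (hA _ _).1 h1 with h1 | h1 | ⟨rfl, rfl⟩
      · have h10 := hdist (x, y) ⟨_, hu, h1, h3, h5, hcr (T.ends _ _ h1).2 (B.ends _ _ h2).1 h7⟩
        rw [hℓold _ _ h1]
        by_cases hn : (x', y') = (v, t)
        · rw [hn, hℓ]; omega
        · rw [hℓ' _ hn]; have := hlt hn; omega
      · have h10 := hbr (B.ends _ _ h1).2 h7
        have hn : (x', y') ≠ (v, t) := by
          rintro ⟨⟩
          exact B.top _ _ h1 h3 (B.eq_root_of_anc h10)
        rw [hℓ' _ hn]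
        by_cases hn' : (x, y) = (v, t)
        · rw [hn', hℓ]; have := hlt hn; omega
        · rw [hℓ' _ hn']
          exact hincr _ _ _ _ h1 h2 h3 h4 h5 h6 h10 h9
      · exact absurd h5 huv
    · exact absurd h6 huv

end Graft

/-- Along the path to the working vertex no label exceeds the label of the last matched arc. -/
theorem label_le (L : Live M R ℓ α st) {u x y : V} (hu : st.working = some (R u))
    (hm : M.Adj x y) (hc : R x ≠ R y) (hy : R y = R u) {a : V × V} (ha : OnPath M R st a) :
    ℓ a ≤ ℓ (x, y) := by
  obtain ⟨W, h1, h2, h3, h4, h5⟩ := ha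
  obtain rfl : R u = W := by simpa [hu] using h1
  have T := L.tree
  have ho := L.out _ hu
  have hxy := T.arc_of_crossing (hy ▸ ho) hm hc
  by_cases h6 : R a.2 = R y
  · obtain ⟨rfl, rfl⟩ := T.uniq a.1 a.2 x y h2 hxy h3 hc h6
    exact le_rfl
  · have h7 := T.anc_parent (hy ▸ h5) h6 (.mk hxy hc)
    exact (L.incr _ hu a.1 a.2 x y h2 hxy h3 hc h4 hm h7 (hy ▸ .refl)).le

/-- Needed in contrapositive form for distance `0`: if no matched arc enters the working vertex,
that vertex is the root and the active path has no matched arc. -/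
theorem exists_entering_of_onPath (L : Live M R ℓ α st) {u : V} (hu : st.working = some (R u))
    {a : V × V} (ha : OnPath M R st a) : ∃ x y, M.Adj x y ∧ R x ≠ R y ∧ R y = R u := by
  obtain ⟨W, h1, h2, h3, h4, h5⟩ := ha
  obtain rfl : R u = W := by simpa [hu] using h1
  rcases L.out _ hu with h | ⟨x, y, -, h6, h7, h8⟩
  · exact absurd (L.tree.eq_root_of_anc (h ▸ h5)) (L.tree.top _ _ h2 h3)
  · exact ⟨x, y, h7, h6, h8⟩

end Live

/-! ### Structures untouched by a change of classes or labels elsewhere -/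

section Congr

variable {R R' : V → Finset V} {ℓ ℓ' : V × V → ℕ} {α : V} {S : Finset V} {A : Finset (V × V)}

theorem AltTree.classArc_congr (T : AltTree M R α S A) (h : ∀ x ∈ S, R' x = R x)
    (X Y : Finset V) : ClassArc R' A X Y ↔ ClassArc R A X Y := by
  have : ∀ a ∈ A, R' a.1 = R a.1 ∧ R' a.2 = R a.2 := fun a ha =>
    ⟨h _ (T.ends a.1 a.2 ha).1, h _ (T.ends a.1 a.2 ha).2⟩
  constructor
  · rintro ⟨hn, a, ha, h1, h2⟩
    exact ⟨hn, a, ha, (this a ha).1 ▸ h1, (this a ha).2 ▸ h2⟩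
  · rintro ⟨hn, a, ha, h1, h2⟩
    exact ⟨hn, a, ha, (this a ha).1.trans h1, (this a ha).2.trans h2⟩

theorem AltTree.anc_congr (T : AltTree M R α S A) (h : ∀ x ∈ S, R' x = R x) :
    Anc R' A = Anc R A := by
  have : ClassArc R' A = ClassArc R A := by
    funext X Y; exact propext (T.classArc_congr h X Y)
  rw [Anc, this]

theorem AltTree.out_congr (T : AltTree M R α S A) (h : ∀ x ∈ S, R' x = R x) :
    Out M R' α A = Out M R α A := by
  funext X
  refine propext (or_congr (by rw [h _ T.self]) ?_)
  refine exists_congr fun x => exists_congr fun y => and_congr_right fun hxy => ?_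
  rw [h _ (T.ends _ _ hxy).1, h _ (T.ends _ _ hxy).2]

theorem AltTree.congr (T : AltTree M R α S A) (h : ∀ x ∈ S, R' x = R x) (hr : ∀ x, x ∈ R' x)
    (hc : ∀ x ∈ S, ∀ y, R' y = R' x → y ∈ S) : AltTree M R' α S A := by
  have h1 := fun {x y} hxy => h _ (T.ends x y hxy).1
  have h2 := fun {x y} hxy => h _ (T.ends x y hxy).2
  refine ⟨T.self, T.free, hr, hc, T.ends, ?_, ?_, ?_, ?_, ?_, ?_, T.cov⟩
  · intro x y x' y' ha hb
    rw [h1 ha, h2 ha, h1 hb, h2 hb]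
    exact T.uniq _ _ _ _ ha hb
  · intro x y ha
    rw [h1 ha, h2 ha, h _ T.self]
    exact T.top _ _ ha
  · intro x hx
    rw [T.anc_congr h, h _ hx, h _ T.self]
    exact T.reach x hx
  · intro x y ha
    rw [h1 ha, h2 ha]
    intro h3 h4
    obtain ⟨h5, p, h6, h7⟩ := T.mat _ _ ha h3 h4
    exact ⟨h5, p, h6, by rwa [h1 h6]⟩
  · intro x y ha
    rw [h1 ha, h2 ha, T.out_congr h]
    intro h3 h4
    obtain ⟨h5, ⟨t, h6, h7⟩, h8⟩ := T.unm _ _ ha h3 h4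
    exact ⟨h5, ⟨t, h6, by rwa [h2 h6]⟩, h8⟩
  · intro x hx y hxy
    obtain ⟨h3, h4⟩ := T.closed x hx y hxy
    rw [h x hx, h y h3]
    exact ⟨h3, h4⟩

theorem Live.congr {st : FreeStructure V} (L : Live M R ℓ α st)
    (h : ∀ x ∈ st.verts, R' x = R x) (hr : ∀ x, x ∈ R' x)
    (hc : ∀ x ∈ st.verts, ∀ y, R' y = R' x → y ∈ st.verts) (hℓ : ∀ a ∈ st.arcs, ℓ' a = ℓ a) :
    Live M R' ℓ' α st ∧ ∀ a, OnPath M R' st a → OnPath M R st a := by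
  have T := L.tree
  have h1 := fun {x y} hxy => h _ (T.ends x y hxy).1
  have h2 := fun {x y} hxy => h _ (T.ends x y hxy).2
  refine ⟨⟨T.congr h hr hc, ?_, ?_, ?_⟩, ?_⟩
  · intro x y ha
    rw [h1 ha, h2 ha, hℓ _ ha]
    exact L.pos _ _ ha
  · rw [T.out_congr h]
    exact L.out
  · intro W hW x y x' y' ha hb
    rw [T.anc_congr h, h1 ha, h2 ha, h1 hb, h2 hb, hℓ _ ha, hℓ _ hb]
    exact L.incr W hW _ _ _ _ ha hb
  · rintro ⟨x, y⟩ ⟨W, h3, h4, h5⟩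
    rw [T.anc_congr h, h1 h4, h2 h4] at h5
    exact ⟨W, h3, h4, h5⟩

end Congr

/-! ### Contracting a cycle of the tree -/

/-- `C` is the union of the classes on the tree path between `R u` and `R v`. -/
def IsCycle (R : V → Finset V) (A : Finset (V × V)) (u v : V) (C : Finset V) : Prop :=
  ∀ x, x ∈ C ↔ (Anc R A (R x) (R u) ∨ Anc R A (R x) (R v)) ∧
    ∀ Y, Anc R A Y (R u) → Anc R A Y (R v) → Anc R A Y (R x)

/-- `R'` arises from `R` by merging all classes inside `C`. -/
def IsMerge (R R' : V → Finset V) (C : Finset V) : Prop :=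
  ∀ x, R' x = if x ∈ C then C else R x

namespace IsCycle

variable {R R' : V → Finset V} {α u v : V} {S C : Finset V} {A A' : Finset (V × V)}

theorem symm (hC : IsCycle R A u v C) : IsCycle R A v u C := fun x => by
  rw [hC x, or_comm]
  exact and_congr_right fun _ => forall_congr' fun Y => ⟨fun h h1 h2 => h h2 h1,
    fun h h1 h2 => h h2 h1⟩

theorem left_mem (hC : IsCycle R A u v C) : u ∈ C := (hC u).2 ⟨.inl .refl, fun _ h _ => h⟩

theorem right_mem (hC : IsCycle R A u v C) : v ∈ C := hC.symm.left_mem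

theorem congr (hC : IsCycle R A u v C) {x y : V} (h : R x = R y) : x ∈ C ↔ y ∈ C := by
  rw [hC x, hC y, h]

theorem subset (hC : IsCycle R A u v C) (T : AltTree M R α S A) (hu : u ∈ S) (hv : v ∈ S)
    {x : V} (hx : x ∈ C) : x ∈ S :=
  ((hC x).1 hx).1.elim (T.mem_of_anc_left · hu) (T.mem_of_anc_left · hv)

/-- The class through which the tree enters the cycle is a common ancestor of both ends. -/
theorem common (hC : IsCycle R A u v C) (T : AltTree M R α S A) {x y : V} (h : (x, y) ∈ A)
    (hc : R x ≠ R y) (hx : x ∉ C) (hy : y ∈ C) :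
    Anc R A (R y) (R u) ∧ Anc R A (R y) (R v) := by
  rw [hC] at hx hy
  have h1 : Anc R A (R x) (R u) ∨ Anc R A (R x) (R v) :=
    hy.1.imp (.head (.mk h hc)) (.head (.mk h hc))
  by_contra hn
  refine hx ⟨h1, fun Y hYu hYv => T.anc_parent (hy.2 Y hYu hYv) ?_ (.mk h hc)⟩
  rintro rfl
  exact hn ⟨hYu, hYv⟩

/-- A class above the cycle but not on it lies above the point where the two tree paths split, hence
above both ends. Otherwise it would sit on one of the two sides. -/
theorem above (hC : IsCycle R A u v C) (T : AltTree M R α S A) {x z : V} (hx : x ∈ C)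
    (hz : z ∉ C) (h : Anc R A (R z) (R x)) : Anc R A (R z) (R u) := by
  rcases ((hC x).1 hx).1 with h1 | h1
  · exact h.trans h1
  · by_contra hn
    refine hz ((hC z).2 ⟨.inr (h.trans h1), fun Y hYu hYv => ?_⟩)
    exact (T.comparable hYv (h.trans h1)).resolve_right fun h2 => hn (h2.trans hYu)

/-- The ends of the cycle are outer, so a tree path through an inner vertex cannot stop there and
must continue to its only child. -/
theorem head_mem (hC : IsCycle R A u v C) (T : AltTree M R α S A) (hM : M.IsMatching)
    (hu : Out M R α A (R u)) (hv : Out M R α A (R v)) {x y : V} (h : (x, y) ∈ A)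
    (hc : R x ≠ R y) (hm : M.Adj x y) (hx : x ∈ C) : y ∈ C := by
  obtain ⟨-, p, h1, h2, h3⟩ := T.mat _ _ h hc hm
  have key : ∀ w, Out M R α A (R w) → Anc R A (R x) (R w) → Anc R A (R y) (R w) := fun w hw hxw =>
    T.anc_child hM h1 h2 h3 hm hxw fun h4 => T.not_out h1 h2 h3 (h4 ▸ hw)
  have hx' := (hC x).1 hx
  exact (hC y).2 ⟨hx'.1.imp (key u hu) (key v hv), fun Y hYu hYv =>
    (hx'.2 Y hYu hYv).tail (.mk h hc)⟩

/-- If the tail were outside, `y` would be an inner common ancestor of both ends. Since the ends are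
outer, its only child would be a common ancestor too, and `y`, being on the cycle, would lie below
its own child. -/
theorem tail_mem (hC : IsCycle R A u v C) (T : AltTree M R α S A) (hM : M.IsMatching)
    (hu : Out M R α A (R u)) (hv : Out M R α A (R v)) {x y : V} (h : (x, y) ∈ A)
    (hc : R x ≠ R y) (hm : ¬ M.Adj x y) (hy : y ∈ C) : x ∈ C := by
  by_contra hx
  obtain ⟨hyu, hyv⟩ := hC.common T h hc hx hy
  obtain ⟨-, ⟨t, h1, h2, h3⟩, -⟩ := T.unm _ _ h hc hm
  have key : ∀ w, Out M R α A (R w) → Anc R A (R y) (R w) → Anc R A (R t) (R w) := fun w hw hyw =>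
    T.anc_child hM h hc hm h3 hyw fun h4 => T.not_out h hc hm (h4 ▸ hw)
  exact h2.symm (T.acyclic (T.ends _ _ h).2 (ClassArc.anc h1 h2)
    (((hC y).1 hy).2 _ (key u hu hyu) (key v hv hyv)))

/-- The cycle contains a matched arc of the tree. -/
theorem exists_matched (hC : IsCycle R A u v C) (T : AltTree M R α S A)
    (hu : Out M R α A (R u)) (hv : Out M R α A (R v)) (huv : R u ≠ R v) :
    ∃ x y, (x, y) ∈ A ∧ R x ≠ R y ∧ M.Adj x y ∧ x ∈ C ∧ y ∈ C := by
  -- The ends cannot be ancestors of each other, so after a swap the matched arc entering `R u` is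
  -- not on the common part of the paths and belongs to the cycle.
  wlog hn : ¬ Anc R A (R u) (R v) generalizing u v
  · rw [not_not] at hn
    exact this hC.symm hv hu huv.symm fun h => huv.symm (T.acyclic (T.mem_of_out hu) hn h)
  rcases hu with h | ⟨x, y, h1, h2, h3, h4⟩
  · exact absurd (h ▸ T.reach v (T.mem_of_out hv)) hn
  · refine ⟨x, y, h1, h2, h3, (hC x).2 ⟨.inl (h4 ▸ ClassArc.anc h1 h2), fun Y hYu hYv => ?_⟩,
      (hC.congr h4).2 hC.left_mem⟩
    refine T.anc_parent (h4 ▸ hYu) ?_ (.mk h1 h2)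
    rintro rfl
    exact hn (h4 ▸ hYv)

end IsCycle

namespace IsMerge

variable {R R' : V → Finset V} {α u v : V} {S C : Finset V} {A A' : Finset (V × V)}

theorem mem (hR : IsMerge R R' C) {x : V} (hx : x ∈ C) : R' x = C := by rw [hR, if_pos hx]

theorem not_mem (hR : IsMerge R R' C) {x : V} (hx : x ∉ C) : R' x = R x := by rw [hR, if_neg hx]

theorem map (hR : IsMerge R R' C) (hC : IsCycle R A u v C) {x y : V} (h : R x = R y) :
    R' x = R' y := by
  rw [hR, hR, h]
  simp only [hC.congr h]

theorem cases (hR : IsMerge R R' C) (T : AltTree M R α S A) {x y : V} (h : R' x = R' y) :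
    x ∈ C ∧ y ∈ C ∨ x ∉ C ∧ y ∉ C ∧ R x = R y := by
  by_cases hx : x ∈ C <;> by_cases hy : y ∈ C
  · exact .inl ⟨hx, hy⟩
  · rw [hR.mem hx, hR.not_mem hy] at h
    exact absurd (h ▸ T.refl y) hy
  · rw [hR.mem hy, hR.not_mem hx] at h
    exact absurd (h ▸ T.refl x) hx
  · rw [hR.not_mem hy, hR.not_mem hx] at h
    exact .inr ⟨hx, hy, h⟩

/-- The added arc `(u, v)` has both ends in `C`, so it disappears in the contraction. -/
theorem arc_of_cross (hR : IsMerge R R' C) (hC : IsCycle R A u v C)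
    (hA : ∀ x y, (x, y) ∈ A' ↔ (x, y) ∈ A ∨ x = u ∧ y = v) {x y : V} (h : (x, y) ∈ A') (hc : R' x ≠ R' y) :
    (x, y) ∈ A ∧ R x ≠ R y := by
  refine ⟨?_, fun h' => hc (hR.map hC h')⟩
  rcases (hA _ _).1 h with h | ⟨rfl, rfl⟩
  · exact h
  · exact absurd ((hR.mem hC.left_mem).trans (hR.mem hC.right_mem).symm) hc

theorem anc_map (hR : IsMerge R R' C) (hC : IsCycle R A u v C)
    (hA : ∀ x y, (x, y) ∈ A' ↔ (x, y) ∈ A ∨ x = u ∧ y = v) {X Y : V} (h : Anc R A (R X) (R Y)) : Anc R' A' (R' X) (R' Y) := by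
  generalize hZ : R Y = Z at h
  induction h generalizing Y with
  | refl => rw [hR.map hC hZ]
  | tail h1 h2 ih =>
    obtain ⟨a, b, h3, h4, rfl, rfl⟩ := h2.exists_arc
    rw [hR.map hC hZ]
    exact Anc.head_of_tail ((hA _ _).2 (.inl h3)) (ih rfl)

/-- Climbing from `u` towards the root, either the root class is met inside `C` or the climb leaves
`C` through an arc, which is matched by `tail_mem`. -/
theorem out (hR : IsMerge R R' C) (hC : IsCycle R A u v C) (T : AltTree M R α S A)
    (hA : ∀ x y, (x, y) ∈ A' ↔ (x, y) ∈ A ∨ x = u ∧ y = v) (hM : M.IsMatching) (hu : Out M R α A (R u)) (hv : Out M R α A (R v)) :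
    Out M R' α A' C := by
  have key : ∀ Z, Anc R A (R α) Z → ∀ y, R y = Z → y ∈ C → Out M R' α A' C := by
    intro Z hZ
    induction hZ with
    | refl =>
      intro y hy hyC
      exact .inl (hR.mem ((hC.congr hy).1 hyC)).symm
    | tail h1 h2 ih =>
      intro y hy hyC
      obtain ⟨a, b, h3, h4, rfl, rfl⟩ := h2.exists_arc
      by_cases ha : a ∈ C
      · exact ih a rfl ha
      · have hb := (hC.congr hy).1 hyC
        by_cases hm : M.Adj a b
        · refine .inr ⟨a, b, (hA _ _).2 (.inl h3), fun h => ?_, hm, hR.mem hb⟩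
          rcases hR.cases T h with h | h
          exacts [ha h.1, h.2.1 hb]
        · exact absurd (hC.tail_mem T hM hu hv h3 h4 hm hb) ha
  exact key _ (T.reach u (T.mem_of_out hu)) u rfl hC.left_mem

theorem tree (hR : IsMerge R R' C) (hC : IsCycle R A u v C) (T : AltTree M R α S A)
    (hA : ∀ x y, (x, y) ∈ A' ↔ (x, y) ∈ A ∨ x = u ∧ y = v) (hM : M.IsMatching) (hu : Out M R α A (R u)) (hv : Out M R α A (R v)) :
    AltTree M R' α S A' := by
  have huS := T.mem_of_out hu
  have hvS := T.mem_of_out hv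
  have hcr := fun {x y} => hR.arc_of_cross hC hA (x := x) (y := y)
  have hkeep : ∀ x y, (x, y) ∈ A → (x, y) ∈ A' := fun x y h => (hA _ _).2 (.inl h)
  have hne : ∀ x y, R x ≠ R y → x ∉ C → R' x ≠ R' y := fun x y h hx h' => by
    rcases hR.cases T h' with h1 | h1
    exacts [hx h1.1, h h1.2.2]
  have hne' : ∀ x y, R x ≠ R y → y ∉ C → R' x ≠ R' y := fun x y h hx h' =>
    hne y x h.symm hx h'.symm
  have hCout := hR.out hC T hA hM hu hv
  refine ⟨T.self, T.free, ?_, ?_, ?_, ?_, ?_, ?_, ?_, ?_, ?_, T.cov⟩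
  · intro x
    by_cases hx : x ∈ C
    · rwa [hR.mem hx]
    · rw [hR.not_mem hx]; exact T.refl x
  · intro x hx y h
    rcases hR.cases T h with h | h
    · exact hC.subset T huS hvS h.1
    · exact T.cls x hx y h.2.2
  · intro x y h
    rcases (hA _ _).1 h with h | ⟨rfl, rfl⟩
    exacts [T.ends _ _ h, ⟨huS, hvS⟩]
  · intro x y x' y' h1 h2 h3 h4 h5
    obtain ⟨h6, h7⟩ := hcr h1 h3
    obtain ⟨h8, h9⟩ := hcr h2 h4
    refine T.uniq _ _ _ _ h6 h8 h7 h9 ?_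
    rcases hR.cases T h5 with ⟨h, h'⟩ | h
    · have hx : x ∉ C := fun hx => h3 ((hR.mem hx).trans (hR.mem h).symm)
      have hx' : x' ∉ C := fun hx => h4 ((hR.mem hx).trans (hR.mem h').symm)
      -- A head where the tree enters `C` is a common ancestor of both ends, and every class of the
      -- cycle lies below all common ancestors. Two such heads lie below each other, hence are in
      -- the same class.
      obtain ⟨h10, h11⟩ := hC.common T h6 h7 hx h
      obtain ⟨h12, h13⟩ := hC.common T h8 h9 hx' h'
      exact T.acyclic (T.ends _ _ h8).2 (((hC y).1 h).2 _ h12 h13) (((hC y').1 h').2 _ h10 h11)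
    · exact h.2.2
  · intro x y h1 h2 h3
    obtain ⟨h6, h7⟩ := hcr h1 h2
    rcases hR.cases T h3 with ⟨h, h'⟩ | h
    · have hx : x ∉ C := fun hx => h2 ((hR.mem hx).trans (hR.mem h).symm)
      obtain ⟨h10, h11⟩ := hC.common T h6 h7 hx h
      exact T.top _ _ h6 h7 (T.eq_root_of_anc (((hC α).1 h').2 _ h10 h11))
    · exact T.top _ _ h6 h7 h.2.2
  · intro x hx
    exact hR.anc_map hC hA (T.reach x hx)
  · intro x y h1 h2 h3
    obtain ⟨h6, h7⟩ := hcr h1 h2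
    obtain ⟨h8, p, h9, h10, h11⟩ := T.mat _ _ h6 h7 h3
    have hx : x ∉ C := fun hx => h2 ((hR.mem hx).trans
      (hR.mem (hC.head_mem T hM hu hv h6 h7 h3 hx)).symm)
    exact ⟨by rw [hR.not_mem hx, h8], p, hkeep _ _ h9, hne' _ _ h10 hx, h11⟩
  · intro x y h1 h2 h3
    obtain ⟨h6, h7⟩ := hcr h1 h2
    obtain ⟨h8, ⟨t, h9, h10, h11⟩, h12⟩ := T.unm _ _ h6 h7 h3
    have hy : y ∉ C := fun hy => h2 ((hR.mem (hC.tail_mem T hM hu hv h6 h7 h3 hy)).trans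
      (hR.mem hy).symm)
    refine ⟨by rw [hR.not_mem hy, h8], ⟨t, hkeep _ _ h9, hne _ _ h10 hy, h11⟩, ?_⟩
    by_cases hx : x ∈ C
    · rwa [hR.mem hx]
    · rcases h12 with h12 | ⟨a, b, h12, h13, h14, h15⟩
      · exact .inl (hR.map hC h12)
      · exact .inr ⟨a, b, hkeep _ _ h12, hne' _ _ h13 ((hC.congr h15).not.2 hx), h14,
          hR.map hC h15⟩
  · intro x hx y h
    obtain ⟨h1, h2⟩ := T.closed x hx y h
    exact ⟨h1, h2.imp (hR.map hC) (.imp (hkeep _ _) (hkeep _ _))⟩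

/-- A path in the contracted tree lifts to the old tree until it first reaches `C`. -/
theorem anc_or (hR : IsMerge R R' C) (hC : IsCycle R A u v C) (T : AltTree M R α S A)
    (hA : ∀ x y, (x, y) ∈ A' ↔ (x, y) ∈ A ∨ x = u ∧ y = v) {y z : V} (h : Anc R' A' (R' y) (R' z)) :
    (∃ c ∈ C, Anc R A (R y) (R c)) ∨ z ∉ C ∧ Anc R A (R y) (R z) := by
  generalize hZ : R' z = Z at h
  induction h generalizing z with
  | refl =>
    rcases hR.cases T hZ with h | h
    · exact .inl ⟨y, h.2, .refl⟩
    · rw [h.2.2]; exact .inr ⟨h.1, .refl⟩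
  | tail h1 h2 ih =>
    obtain ⟨a, b, h3, h4, rfl, rfl⟩ := h2.exists_arc
    obtain ⟨h5, h6⟩ := hR.arc_of_cross hC hA h3 h4
    rcases ih rfl with h | ⟨-, h⟩
    · exact .inl h
    · rcases hR.cases T hZ with h' | h'
      · exact .inl ⟨b, h'.2, h.tail (.mk h5 h6)⟩
      · exact .inr ⟨h'.1, h'.2.2 ▸ h.tail (.mk h5 h6)⟩

/-- This keeps the new active path, which ends at `C`, within the old one, which ended at `R u`. -/
theorem anc_left_of_cross (hR : IsMerge R R' C) (hC : IsCycle R A u v C) (T : AltTree M R α S A)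
    (hA : ∀ x y, (x, y) ∈ A' ↔ (x, y) ∈ A ∨ x = u ∧ y = v) {x y : V} (h : (x, y) ∈ A') (hc : R' x ≠ R' y)
    (hy : Anc R' A' (R' y) C) : Anc R A (R y) (R u) := by
  obtain ⟨h1, h2⟩ := hR.arc_of_cross hC hA h hc
  by_cases hyC : y ∈ C
  · have hx : x ∉ C := fun hx => hc ((hR.mem hx).trans (hR.mem hyC).symm)
    exact (hC.common T h1 h2 hx hyC).1
  · rw [← hR.mem hC.left_mem] at hy
    rcases hR.anc_or hC T hA hy with ⟨c, h3, h4⟩ | h3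
    · exact hC.above T h3 hyC h4
    · exact absurd hC.left_mem h3.1

theorem anc_of_not_mem (hR : IsMerge R R' C) (hC : IsCycle R A u v C) (T : AltTree M R α S A)
    (hA : ∀ x y, (x, y) ∈ A' ↔ (x, y) ∈ A ∨ x = u ∧ y = v) {y z : V} (hy : y ∉ C) (hz : z ∉ C) (h : Anc R' A' (R' y) (R' z)) :
    Anc R' A' C (R' z) ∨ Anc R A (R y) (R z) := by
  generalize hZ : R' z = Z at h
  induction h generalizing z with
  | refl =>
    rcases hR.cases T hZ with h | h
    · exact absurd h.2 hy
    · rw [h.2.2]; exact .inr .refl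
  | tail h1 h2 ih =>
    obtain ⟨a, b, h3, h4, rfl, rfl⟩ := h2.exists_arc
    obtain ⟨h5, h6⟩ := hR.arc_of_cross hC hA h3 h4
    by_cases ha : a ∈ C
    · exact .inl (.single ⟨(hR.mem ha) ▸ h4, (a, b), h3, hR.mem ha, rfl⟩)
    · rcases hR.cases T hZ with h' | h'
      · exact absurd h'.1 hz
      · rw [h'.2.2]
        exact (ih ha rfl).imp (·.tail h2) (·.tail (.mk h5 h6))

end IsMerge

/-- Contracting the cycle closed by an arc between the working vertex and an outer vertex. -/
theorem Live.contract {R R' : V → Finset V} {ℓ ℓ' : V × V → ℕ} {α u v : V} {C : Finset V}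
    {st st' : FreeStructure V} (L : Live M R ℓ α st) (hM : M.IsMatching)
    (hC : IsCycle R st.arcs u v C) (hR : IsMerge R R' C) (hu : st.working = some (R u))
    (hv : Out M R α st.arcs (R v)) (hS : st'.verts = st.verts)
    (hA : ∀ x y, (x, y) ∈ st'.arcs ↔ (x, y) ∈ st.arcs ∨ x = u ∧ y = v)
    (hW : st'.working = some C) (hℓ : ∀ x y, ¬ (x ∈ C ∧ y ∈ C) → ℓ' (x, y) = ℓ (x, y)) :
    Live M R' ℓ' α st' ∧ ∀ a, OnPath M R' st' a → OnPath M R st a := by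
  have T := L.tree
  have huO := L.out _ hu
  have T' := hR.tree hC T hA hM huO hv
  have hcr := fun {x y} => hR.arc_of_cross hC hA (x := x) (y := y)
  have hlab : ∀ x y, R' x ≠ R' y → ℓ' (x, y) = ℓ (x, y) := fun x y h => hℓ _ _ fun h' =>
    h ((hR.mem h'.1).trans (hR.mem h'.2).symm)
  have hCu : C = R' u := (hR.mem hC.left_mem).symm
  refine ⟨⟨hS ▸ T', ?_, ?_, ?_⟩, ?_⟩
  · intro x y h1 h2 h3
    obtain ⟨h4, h5⟩ := hcr h1 h2
    rw [hlab _ _ h2]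
    exact L.pos _ _ h4 h5 h3
  · intro W h
    obtain rfl : C = W := by simpa [hW] using h
    exact hR.out hC T hA hM huO hv
  · intro W h x y x' y' h1 h2 h3 h4 h5 h6 h7 h8
    obtain rfl : C = W := by simpa [hW] using h
    obtain ⟨h9, h10⟩ := hcr h1 h3
    obtain ⟨h11, h12⟩ := hcr h2 h4
    rw [hlab _ _ h3, hlab _ _ h4]
    -- The class `C` is the end of the new active path, so the tail of an arc of that path cannot
    -- also lie below it. Hence the segment between the two arcs avoids `C` and lifts to the old
    -- tree.
    have hcyc : ¬ Anc R' st'.arcs C (R' x') := fun h13 => by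
      have h14 : Anc R' st'.arcs (R' x') C := .head (.mk h2 h4) h8
      have h15 := T'.acyclic (T.ends _ _ h11).1 h14 h13
      rw [h15] at h8
      exact h4.symm (T'.acyclic (T.ends _ _ h11).1 (ClassArc.anc h2 h4) h8)
    have hx' : x' ∉ C := fun h => hcyc (by rw [hR.mem h])
    have hy : y ∉ C := fun h => hcyc (by rwa [hR.mem h] at h7)
    exact L.incr _ hu _ _ _ _ h9 h11 h10 h12 h5 h6
      ((hR.anc_of_not_mem hC T hA hy hx' h7).resolve_left hcyc)
      (hR.anc_left_of_cross hC T hA h2 h4 h8)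
  · rintro ⟨x, y⟩ ⟨W, h1, h2, h3, h4, h5⟩
    obtain rfl : C = W := by simpa [hW] using h1
    obtain ⟨h6, h7⟩ := hcr h2 h3
    exact ⟨_, hu, h6, h7, h4, hR.anc_left_of_cross hC T hA h2 h3 h5⟩

/-! ### Invariants of phase states -/

namespace PhaseState

variable [Fintype V] {s s' : PhaseState V}

theorem mem_family {B : Finset V} :
    B ∈ s.family ↔ (∃ v, B = {v}) ∨ ∃ α, B ∈ (s.struct α).blossoms := by
  simp [family, eq_comm]

theorem mem_root_iff {x y : V} : y ∈ s.root x ↔ ∃ B ∈ s.family, x ∈ B ∧ y ∈ B := by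
  simp [root, Finset.mem_sup, and_assoc]

theorem self_mem_root (s : PhaseState V) (x : V) : x ∈ s.root x :=
  mem_root_iff.2 ⟨{x}, mem_family.2 (.inl ⟨x, rfl⟩), by simp, by simp⟩

theorem root_congr (h : ∀ B, B ∈ s'.family ↔ B ∈ s.family) : s'.root = s.root := by
  have : s'.family = s.family := Finset.ext h
  funext x
  simp only [root, this]

/-- Invariants of the states that occur in a phase. -/
structure Inv (M : G.Subgraph) (s : PhaseState V) : Prop where
  lam : ∀ B ∈ s.family, ∀ x ∈ B, ∀ y ∈ B, s.root x = s.root y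
  sub : ∀ α, ∀ B ∈ (s.struct α).blossoms, B ⊆ (s.struct α).verts
  disj : ∀ α β x, x ∈ (s.struct α).verts → x ∈ (s.struct β).verts → α = β
  live : ∀ α, s.struct α = FreeStructure.empty V ∨ Live M s.root s.label α (s.struct α)

/-- The matched arcs on the active paths. -/
def activeArcs (M : G.Subgraph) (s : PhaseState V) : Set (V × V) :=
  {a | ∃ α, OnPath M s.root (s.struct α) a}

theorem isCycle_cycle (s : PhaseState V) (α u v : V) :
    IsCycle s.root (s.struct α).arcs u v (s.cycle α u v) := by
  intro x
  simp only [cycle, Finset.mem_filter, Finset.mem_univ, true_and]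
  rfl

namespace Inv

theorem root_eq_of_mem (I : Inv M s) {x y : V} (h : y ∈ s.root x) : s.root y = s.root x := by
  obtain ⟨B, hB, hx, hy⟩ := mem_root_iff.1 h
  exact I.lam B hB y hy x hx

theorem mem_of_mem_root (I : Inv M s) {x y α : V} (hx : x ∈ (s.struct α).verts)
    (h : y ∈ s.root x) : y ∈ (s.struct α).verts := by
  obtain ⟨B, hB, hxB, hyB⟩ := mem_root_iff.1 h
  rcases mem_family.1 hB with ⟨v, rfl⟩ | ⟨β, hβ⟩
  · rw [Finset.mem_singleton] at hxB hyB
    rwa [hyB, ← hxB]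
  · rw [I.disj α β x hx (I.sub β B hβ hxB)]
    exact I.sub β B hβ hyB

theorem root_eq_singleton (I : Inv M s) {x : V} (hx : ∀ α, x ∉ (s.struct α).verts) :
    s.root x = {x} := by
  ext y
  rw [mem_root_iff, Finset.mem_singleton]
  constructor
  · rintro ⟨B, hB, hxB, hyB⟩
    rcases mem_family.1 hB with ⟨v, rfl⟩ | ⟨β, hβ⟩
    · rw [Finset.mem_singleton] at hxB hyB
      rw [hyB, hxB]
    · exact absurd (I.sub β B hβ hxB) (hx β)
  · rintro rfl
    exact ⟨{y}, mem_family.2 (.inl ⟨y, rfl⟩), by simp, by simp⟩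

theorem live_of_mem (I : Inv M s) {α x : V} (hx : x ∈ (s.struct α).verts) :
    Live M s.root s.label α (s.struct α) :=
  (I.live α).resolve_left fun h => by rw [h] at hx; simp [FreeStructure.empty] at hx

theorem live_of_arc (I : Inv M s) {α : V} {a : V × V} (hx : a ∈ (s.struct α).arcs) :
    Live M s.root s.label α (s.struct α) :=
  (I.live α).resolve_left fun h => by rw [h] at hx; simp [FreeStructure.empty] at hx

theorem live_of_working (I : Inv M s) {α : V} {W : Finset V} (h : (s.struct α).working = some W) :
    Live M s.root s.label α (s.struct α) :=
  (I.live α).resolve_left fun h' => by rw [h'] at h; simp [FreeStructure.empty] at h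

/-- A structure that does not change stays live if the classes of its vertices and the labels of its
arcs do not change. -/
theorem live_congr (I : Inv M s) {α : V} (hst : s'.struct α = s.struct α)
    (hr : ∀ x ∈ (s.struct α).verts, s'.root x = s.root x)
    (hℓ : ∀ a ∈ (s.struct α).arcs, s'.label a = s.label a) :
    (s'.struct α = FreeStructure.empty V ∨ Live M s'.root s'.label α (s'.struct α)) ∧
      ∀ a, OnPath M s'.root (s'.struct α) a → OnPath M s.root (s.struct α) a := by
  rw [hst]
  rcases I.live α with h | L
  · refine ⟨.inl h, ?_⟩
    rintro a ⟨W, hW, -⟩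
    rw [h] at hW
    simp [FreeStructure.empty] at hW
  · refine (L.congr hr s'.self_mem_root (fun x hx y h => ?_) hℓ).imp .inr id
    refine I.mem_of_mem_root hx ?_
    rw [← hr x hx, ← h]
    exact s'.self_mem_root y

end Inv

/-- Matched and unmatched arcs alternate going down the tree. The induction carries the even and the
odd case together, since each step uses the other parity. -/
theorem IsOuter.out {α : V} {X : Finset V}
    (T : AltTree M s.root α (s.struct α).verts (s.struct α).arcs) (h : s.IsOuter α X) :
    Out M s.root α (s.struct α).arcs X := by
  obtain ⟨n, hn, hd⟩ := h
  have key : (Even n → Out M s.root α (s.struct α).arcs X) ∧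
      (¬ Even n → ¬ Out M s.root α (s.struct α).arcs X) := by
    clear hn
    induction hd with
    | base _ => exact ⟨fun _ => .inl rfl, fun h => absurd (by simp) h⟩
    | step _ h ih =>
      obtain ⟨x, y, h1, h2, rfl, rfl⟩ := ClassArc.exists_arc h
      rw [Nat.even_add_one, not_not]
      refine ⟨fun h3 => ?_, fun h3 => ?_⟩
      · refine .inr ⟨x, y, h1, h2, ?_, rfl⟩
        by_contra hm
        exact ih.2 h3 (T.unm _ _ h1 h2 hm).2.2
      · exact T.not_out h1 h2 (T.not_matched_of_out h1 h2 (ih.1 h3))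
  exact key.1 hn

theorem isOuter_of_out {α : V} {X : Finset V}
    (T : AltTree M s.root α (s.struct α).verts (s.struct α).arcs)
    (h : Out M s.root α (s.struct α).arcs X) : s.IsOuter α X := by
  have key : ∀ Z, Anc s.root (s.struct α).arcs (s.root α) Z → ∃ n, s.Depth α n Z := by
    intro Z hZ
    induction hZ with
    | refl => exact ⟨0, .base T.self⟩
    | tail _ h ih =>
      obtain ⟨n, hn⟩ := ih
      exact ⟨n + 1, .step hn h⟩
  have hreach : Anc s.root (s.struct α).arcs (s.root α) X := by
    rcases h with rfl | ⟨x, y, h1, -, -, rfl⟩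
    · exact .refl
    · exact T.reach _ (T.ends _ _ h1).2
  obtain ⟨n, hn⟩ := key X hreach
  by_cases he : Even n
  · exact ⟨n, he, hn⟩
  · rcases h with rfl | ⟨x, y, h1, h2, h3, rfl⟩
    · exact ⟨0, by simp, .base T.self⟩
    · obtain ⟨-, p, h4, h5, h6⟩ := T.mat _ _ h1 h2 h3
      have hinv : ∀ {n Z}, s.Depth α n Z →
          n = 0 ∨ ∃ m W, n = m + 1 ∧ s.Depth α m W ∧ s.TreeArc α W Z := by
        intro n Z h
        cases h with
        | base _ => exact .inl rfl
        | step h h' => exact .inr ⟨_, _, rfl, h, h'⟩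
      -- At odd depth the parent would be at even depth, hence outer. It is the tail of a matched
      -- tree arc and therefore inner.
      rcases hinv hn with rfl | ⟨m, W, rfl, hd, h⟩
      · exact absurd (by simp) he
      · rw [Nat.even_add_one, not_not] at he
        exact absurd (IsOuter.out T ⟨_, he, T.parent_unique (ClassArc.mk h1 h2) h ▸ hd⟩)
          (T.not_out h4 h5 h6)

theorem label_le_of_isDistance (I : Inv M s) {α u : V} {d : ℕ}
    (hu : (s.struct α).working = some (s.root u)) (hd : s.IsDistance M u d) {a : V × V}
    (ha : OnPath M s.root (s.struct α) a) : s.label a ≤ d := by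
  have L := I.live_of_working hu
  rcases hd with ⟨-, h⟩ | ⟨x, y, ⟨h1, h2, h3⟩, rfl⟩
  · exact absurd (L.exists_entering_of_onPath hu ha) h
  · exact L.label_le hu h1 h2 h3 ha

/-! ### Contract and Augment preserve the invariants -/

section Contract

variable {α u v : V}

/-- The only set that can be new in `Ω` is the cycle, and it is a union of existing classes, so
exactly the classes inside it are merged. -/
theorem isMerge_contract (I : Inv M s) :
    IsMerge s.root (s.contract M α u v).root (s.cycle α u v) := by
  have hC := s.isCycle_cycle α u v
  have hf : ∀ B, B ∈ (s.contract M α u v).family ↔ B = s.cycle α u v ∨ B ∈ s.family := by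
    intro B
    simp only [mem_family, contract]
    constructor
    · rintro (h | ⟨γ, h⟩)
      · exact .inr (.inl h)
      · by_cases hγ : γ = α
        · subst hγ
          rw [Function.update_self] at h
          rcases Finset.mem_insert.1 h with h | h
          exacts [.inl h, .inr (.inr ⟨_, h⟩)]
        · rw [Function.update_of_ne hγ] at h
          exact .inr (.inr ⟨_, h⟩)
    · rintro (h | h | ⟨γ, h⟩)
      · exact .inr ⟨α, by rw [Function.update_self]; exact Finset.mem_insert.2 (.inl h)⟩
      · exact .inl h
      · refine .inr ⟨γ, ?_⟩
        by_cases hγ : γ = α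
        · subst hγ
          rw [Function.update_self]
          exact Finset.mem_insert.2 (.inr h)
        · rwa [Function.update_of_ne hγ]
  intro x
  ext y
  have h1 : y ∈ (s.contract M α u v).root x ↔
      (x ∈ s.cycle α u v ∧ y ∈ s.cycle α u v) ∨ y ∈ s.root x := by
    simp only [mem_root_iff, hf]
    constructor
    · rintro ⟨B, rfl | hB, h⟩
      exacts [.inl h, .inr ⟨B, hB, h⟩]
    · rintro (h | ⟨B, hB, h⟩)
      exacts [⟨_, .inl rfl, h⟩, ⟨B, .inr hB, h⟩]
  rw [h1]
  split_ifs with hx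
  · refine ⟨?_, fun h => .inl ⟨hx, h⟩⟩
    rintro (h | h)
    · exact h.2
    · exact (hC.congr (I.root_eq_of_mem h)).2 hx
  · simp [hx]

theorem Inv.contract (I : Inv M s) (hM : M.IsMatching)
    (hu : (s.struct α).working = some (s.root u)) (hv : s.IsOuter α (s.root v)) :
    Inv M (s.contract M α u v) ∧ activeArcs M (s.contract M α u v) ⊆ activeArcs M s := by
  have hC := s.isCycle_cycle α u v
  have hR := isMerge_contract (α := α) (u := u) (v := v) I
  have L := I.live_of_working hu
  have hvO := hv.out L.tree
  have hsub : s.cycle α u v ⊆ (s.struct α).verts := fun x hx =>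
    hC.subset L.tree (L.tree.mem_of_out (L.out _ hu)) (L.tree.mem_of_out hvO) hx
  have hverts : ∀ γ, ((s.contract M α u v).struct γ).verts = (s.struct γ).verts := by
    intro γ
    by_cases hγ : γ = α
    · subst hγ; simp [PhaseState.contract]
    · simp [PhaseState.contract, hγ]
  have hα : Live M (s.contract M α u v).root (s.contract M α u v).label α
      ((s.contract M α u v).struct α) ∧ ∀ a,
        OnPath M (s.contract M α u v).root ((s.contract M α u v).struct α) a →
          OnPath M s.root (s.struct α) a := by
    refine L.contract hM hC hR hu hvO (hverts α) ?_ ?_ ?_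
    · intro x y
      simp [PhaseState.contract, or_comm]
    · simp [PhaseState.contract]
    · intro x y h
      exact if_neg fun h' => h h'.2
  have hγ : ∀ γ, γ ≠ α → _ := fun γ hγ => I.live_congr (s' := s.contract M α u v) (α := γ)
    (Function.update_of_ne hγ _ _)
    (fun x hx => hR.not_mem fun h => hγ (I.disj _ _ _ hx (hsub h)))
    (fun a ha => if_neg fun h => hγ (I.disj _ _ a.1
      ((I.live_of_arc ha).tree.ends a.1 a.2 ha).1 (hsub h.2.1)))
  refine ⟨⟨?_, ?_, ?_, ?_⟩, ?_⟩
  · intro B hB x hx y hy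
    rcases mem_family.1 hB with ⟨v, rfl⟩ | ⟨γ, hB⟩
    · rw [Finset.mem_singleton] at hx hy
      rw [hx, hy]
    · have hB' : B = s.cycle α u v ∨ B ∈ s.family := by
        by_cases hγ : γ = α
        · subst hγ
          simp only [PhaseState.contract, Function.update_self] at hB
          exact (Finset.mem_insert.1 hB).imp id fun h => mem_family.2 (.inr ⟨_, h⟩)
        · simp only [PhaseState.contract, Function.update_of_ne hγ] at hB
          exact .inr (mem_family.2 (.inr ⟨_, hB⟩))
      rcases hB' with rfl | hB'
      · rw [hR.mem hx, hR.mem hy]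
      · exact hR.map hC (I.lam B hB' x hx y hy)
  · intro γ B hB
    rw [hverts]
    by_cases hγ : γ = α
    · subst hγ
      simp only [PhaseState.contract, Function.update_self] at hB
      rcases Finset.mem_insert.1 hB with rfl | hB
      exacts [hsub, I.sub _ _ hB]
    · simp only [PhaseState.contract, Function.update_of_ne hγ] at hB
      exact I.sub _ _ hB
  · intro γ δ x
    rw [hverts, hverts]
    exact I.disj γ δ x
  · intro γ
    by_cases h : γ = α
    · subst h; exact .inr hα.1
    · exact (hγ γ h).1
  · rintro a ⟨γ, ha⟩
    refine ⟨γ, ?_⟩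
    by_cases h : γ = α
    · subst h; exact hα.2 a ha
    · exact (hγ γ h).2 a ha

/-- A contraction sets the label of some matched arc from a positive value to `0`. -/
theorem exists_label_contract (I : Inv M s)
    (hu : (s.struct α).working = some (s.root u)) (hv : s.IsOuter α (s.root v))
    (huv : s.root u ≠ s.root v) :
    ∃ a : V × V, M.Adj a.1 a.2 ∧ (s.contract M α u v).label a < s.label a := by
  have L := I.live_of_working hu
  obtain ⟨x, y, h1, h2, h3, h4, h5⟩ := (s.isCycle_cycle α u v).exists_matched L.tree (L.out _ hu)
    (hv.out L.tree) huv
  have h0 : (s.contract M α u v).label (x, y) = 0 := if_pos ⟨h3, h4, h5⟩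
  exact ⟨(x, y), h3, h0 ▸ L.pos _ _ h1 h2 h3⟩

end Contract

/-- The nontrivial blossoms meeting a surviving structure all belong to that structure, so deleting
two whole structures leaves its classes unchanged. -/
theorem Inv.augment (I : Inv M s) {α β : V} (p : List V) :
    Inv M (s.augment α β p) ∧ activeArcs M (s.augment α β p) ⊆ activeArcs M s := by
  have hemp : ∀ γ, γ = α ∨ γ = β → (s.augment α β p).struct γ = FreeStructure.empty V := by
    intro γ h
    by_cases hγ : γ = β
    · subst hγ; simp [PhaseState.augment]
    · obtain rfl := h.resolve_right hγ
      simp [PhaseState.augment, Function.update_of_ne hγ]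
  have hst : ∀ γ, ¬ (γ = α ∨ γ = β) → (s.augment α β p).struct γ = s.struct γ := by
    intro γ h
    rw [not_or] at h
    exact (Function.update_of_ne h.2 _ _).trans (Function.update_of_ne h.1 _ _)
  have hroot : ∀ γ, ¬ (γ = α ∨ γ = β) → ∀ x ∈ (s.struct γ).verts,
      (s.augment α β p).root x = s.root x := by
    intro γ hγ x hx
    ext y
    simp only [mem_root_iff, mem_family]
    refine exists_congr fun B => and_congr_left fun ⟨hxB, _⟩ => or_congr_right ?_
    constructor
    · rintro ⟨δ, hδ⟩
      refine ⟨δ, ?_⟩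
      by_cases h : δ = α ∨ δ = β
      · rw [hemp _ h] at hδ
        simp [FreeStructure.empty] at hδ
      · rwa [hst _ h] at hδ
    · rintro ⟨δ, hδ⟩
      obtain rfl := I.disj _ _ _ hx (I.sub _ _ hδ hxB)
      exact ⟨γ, by rwa [hst _ hγ]⟩
  have hlive := fun γ hγ => I.live_congr (s' := s.augment α β p) (hst γ hγ) (hroot γ hγ)
    (fun _ _ => rfl)
  refine ⟨⟨?_, ?_, ?_, ?_⟩, ?_⟩
  · intro B hB x hx y hy
    rcases mem_family.1 hB with ⟨v, rfl⟩ | ⟨γ, hB⟩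
    · rw [Finset.mem_singleton] at hx hy
      rw [hx, hy]
    · by_cases h : γ = α ∨ γ = β
      · rw [hemp _ h] at hB
        simp [FreeStructure.empty] at hB
      · rw [hst _ h] at hB
        rw [hroot γ h x (I.sub _ _ hB hx), hroot γ h y (I.sub _ _ hB hy)]
        exact I.lam B (mem_family.2 (.inr ⟨_, hB⟩)) x hx y hy
  · intro γ B hB
    by_cases h : γ = α ∨ γ = β
    · rw [hemp _ h] at hB
      simp [FreeStructure.empty] at hB
    · rw [hst _ h] at hB ⊢
      exact I.sub _ _ hB
  · intro γ δ x hx hy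
    by_cases h : γ = α ∨ γ = β
    · rw [hemp _ h] at hx
      simp [FreeStructure.empty] at hx
    · by_cases h' : δ = α ∨ δ = β
      · rw [hemp _ h'] at hy
        simp [FreeStructure.empty] at hy
      · rw [hst _ h] at hx
        rw [hst _ h'] at hy
        exact I.disj _ _ _ hx hy
  · intro γ
    by_cases h : γ = α ∨ γ = β
    · exact .inl (hemp _ h)
    · exact (hlive γ h).1
  · rintro a ⟨γ, ha⟩
    refine ⟨γ, ?_⟩
    by_cases h : γ = α ∨ γ = β
    · obtain ⟨W, hW, -⟩ := ha
      rw [hemp _ h] at hW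
      simp [FreeStructure.empty] at hW
    · exact (hlive γ h).2 a ha

end PhaseState

/-! ### Overtake preserves the invariants -/

/-- The path from `v` to `t` has a single arc, so when the working vertex becomes the class of `t`,
monotonicity inside the branch is vacuous. -/
theorem Branch.not_anc_tip {R : V → Finset V} {v t x y x' y' : V} {S : Finset V}
    {A : Finset (V × V)} (B : Branch M R v t S A) (h1 : (x, y) ∈ A) (h2 : (x', y') ∈ A)
    (h3 : R x ≠ R y) (h4 : R x' ≠ R y') (h5 : Anc R A (R y) (R x')) : ¬ Anc R A (R y') (R t) := by
  intro h6
  obtain ⟨rfl, -⟩ := B.eq_arc_of_anc h2 h4 h6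
  exact B.top _ _ h1 h3 (B.eq_root_of_anc h5)

/-- If `v` were above the working vertex, so would be its only child, and `(v, t)` would be on the
active path with label at most `d`. Thus the label test of Overtake prevents reattachment from
closing a cycle. -/
theorem Live.not_below_working {R : V → Finset V} {ℓ : V × V → ℕ} {α p u v t : V} {d : ℕ}
    {st : FreeStructure V} (L : Live M R ℓ α st) (hM : M.IsMatching)
    (hu : st.working = some (R u)) (h : (p, v) ∈ st.arcs) (hc : R p ≠ R v) (hm : ¬ M.Adj p v)
    (ht : M.Adj v t) (hd : ∀ a, OnPath M R st a → ℓ a ≤ d) (hlt : d + 1 < ℓ (v, t)) :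
    ¬ Anc R st.arcs (R v) (R u) := by
  intro hvu
  have T := L.tree
  have h1 := T.anc_child hM h hc hm ht hvu fun h2 => T.not_out h hc hm (h2 ▸ L.out _ hu)
  obtain ⟨h2, h3⟩ := T.arc_of_inner hM h hc hm ht
  have := hd (v, t) ⟨_, hu, h2, h3, ht, h1⟩
  omega

namespace PhaseState

variable [Fintype V] {s s' : PhaseState V}

/-- Overtaking and backtracking leave `Ω` and therefore all classes unchanged, so liveness can be
checked with the old root map. -/
theorem Inv.of_family (I : Inv M s) (hf : ∀ B, B ∈ s'.family ↔ B ∈ s.family)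
    (hsub : ∀ α, ∀ B ∈ (s'.struct α).blossoms, B ⊆ (s'.struct α).verts)
    (hdisj : ∀ α β x, x ∈ (s'.struct α).verts → x ∈ (s'.struct β).verts → α = β)
    (hlive : ∀ α, s'.struct α = FreeStructure.empty V ∨ Live M s.root s'.label α (s'.struct α)) :
    Inv M s' := by
  have hr := root_congr hf
  refine ⟨fun B hB x hx y hy => ?_, hsub, hdisj, ?_⟩
  · rw [hr]; exact I.lam B ((hf B).1 hB) x hx y hy
  · rw [hr]; exact hlive

section Overtake

variable {α β p u v t : V} {d : ℕ}

theorem mem_subtree {x : V} : x ∈ s.subtree β v ↔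
    x ∈ (s.struct β).verts ∧ Anc s.root (s.struct β).arcs (s.root v) (s.root x) := by
  rw [subtree, Finset.mem_filter]; rfl

/-- The arcs of the subtree of `Ω(v)`. -/
noncomputable def subtreeArcs (s : PhaseState V) (β v : V) : Finset (V × V) :=
  (s.struct β).arcs.filter fun a => Anc s.root (s.struct β).arcs (s.root v) (s.root a.1)

/-- The arcs that remain when the subtree of `Ω(v)` is cut off. -/
noncomputable def restArcs (s : PhaseState V) (β v : V) : Finset (V × V) :=
  (s.struct β).arcs.filter fun a => ¬ Anc s.root (s.struct β).arcs (s.root v) (s.root a.2)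

theorem mem_subtreeArcs {x y : V} : (x, y) ∈ s.subtreeArcs β v ↔
    (x, y) ∈ (s.struct β).arcs ∧ Anc s.root (s.struct β).arcs (s.root v) (s.root x) := by
  rw [subtreeArcs, Finset.mem_filter]

theorem mem_restArcs {x y : V} : (x, y) ∈ s.restArcs β v ↔
    (x, y) ∈ (s.struct β).arcs ∧ ¬ Anc s.root (s.struct β).arcs (s.root v) (s.root y) := by
  rw [restArcs, Finset.mem_filter]

theorem subtree_branch (L : Live M s.root s.label β (s.struct β)) (hM : M.IsMatching)
    (h : (p, v) ∈ (s.struct β).arcs) (hc : s.root p ≠ s.root v) (hm : ¬ M.Adj p v)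
    (ht : M.Adj v t) : Branch M s.root v t (s.subtree β v) (s.subtreeArcs β v) :=
  L.tree.cut_branch hM h hc hm ht (fun _ => mem_subtree) fun _ _ => mem_subtreeArcs

/-- Reconciles the cut defined by ancestry with the operation, which erases `(p, v)` and filters the
remaining arcs by their end vertices. -/
theorem mem_restArcs_iff (T : AltTree M s.root β (s.struct β).verts (s.struct β).arcs)
    (h : (p, v) ∈ (s.struct β).arcs) (hc : s.root p ≠ s.root v) {x y : V} :
    (x, y) ∈ s.restArcs β v ↔ ((x, y) ∈ (s.struct β).arcs ∧ (x, y) ≠ (p, v)) ∧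
      ¬ (x ∈ s.subtree β v ∧ y ∈ s.subtree β v) := by
  rw [mem_restArcs, mem_subtree, mem_subtree]
  constructor
  · rintro ⟨h1, h2⟩
    refine ⟨⟨h1, ?_⟩, fun h3 => h2 h3.2.2⟩
    rintro ⟨⟩
    exact h2 .refl
  · rintro ⟨⟨h1, h2⟩, h3⟩
    refine ⟨h1, fun h4 => h3 ⟨⟨(T.ends _ _ h1).1, T.tail_below h hc h1 h4 h2⟩,
      (T.ends _ _ h1).2, h4⟩⟩

theorem mem_subtreeArcs_iff (T : AltTree M s.root β (s.struct β).verts (s.struct β).arcs) {x y : V} :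
    (x, y) ∈ s.subtreeArcs β v ↔ (x, y) ∈ (s.struct β).arcs ∧
      x ∈ s.subtree β v ∧ y ∈ s.subtree β v := by
  rw [mem_subtreeArcs, mem_subtree, mem_subtree]
  exact and_congr_right fun h => ⟨fun h1 => ⟨⟨(T.ends _ _ h).1, h1⟩, (T.ends _ _ h).2,
    Anc.head_of_tail h h1⟩, fun h1 => h1.1.2⟩

theorem rest_or_subtree (T : AltTree M s.root β (s.struct β).verts (s.struct β).arcs)
    (h : (p, v) ∈ (s.struct β).arcs) (hc : s.root p ≠ s.root v) {x y : V} :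
    ((x, y) ∈ s.restArcs β v ∨ (x, y) ∈ s.subtreeArcs β v) ↔
      (x, y) ∈ (s.struct β).arcs ∧ (x, y) ≠ (p, v) := by
  rw [mem_restArcs_iff T h hc, mem_subtreeArcs_iff T]
  constructor
  · rintro (h1 | ⟨h1, h2, -⟩)
    · exact h1.1
    · refine ⟨h1, ?_⟩
      rintro ⟨⟩
      exact T.not_below_parent h hc (mem_subtree.1 h2).2
  · tauto

theorem subtreeArcs_subset : s.subtreeArcs β v ⊆ (s.struct β).arcs := Finset.filter_subset _ _

theorem restArcs_subset : s.restArcs β v ⊆ (s.struct β).arcs := Finset.filter_subset _ _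

theorem Inv.overtakeNew (I : Inv M s) (hM : M.IsMatching)
    (hu : (s.struct α).working = some (s.root u)) (huv : ¬ M.Adj u v) (ht : M.Adj v t)
    (hv : ¬ ∃ β, s.IsOuter β (s.root v)) (hd : s.IsDistance M u d) (hlt : d + 1 < s.label (v, t))
    (hno : ∀ β, (v, t) ∉ (s.struct β).arcs) :
    Inv M (s.overtakeNew α u v t (d + 1)) ∧
      activeArcs M (s.overtakeNew α u v t (d + 1)) ⊆ insert (v, t) (activeArcs M s) := by
  have L := I.live_of_working hu
  -- A vertex of a structure lies in an outer class or is entered by an unmatched arc. The latter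
  -- would force `(v, t)` to be an arc of that structure.
  have hvS : ∀ β, v ∉ (s.struct β).verts := by
    intro β h
    have T := (I.live_of_mem h).tree
    rcases T.out_or_inner h with h1 | ⟨p, h1, h2, h3⟩
    · exact hv ⟨β, isOuter_of_out T h1⟩
    · exact hno β (T.arc_of_inner hM h1 h2 h3 ht).1
  have htS : ∀ β, t ∉ (s.struct β).verts := fun β h =>
    hvS β ((I.live_of_mem h).tree.closed t h v ht.symm).1
  have hvR := I.root_eq_singleton hvS
  have htR := I.root_eq_singleton htS
  have hf : ∀ B, B ∈ (s.overtakeNew α u v t (d + 1)).family ↔ B ∈ s.family := by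
    intro B
    simp only [mem_family, PhaseState.overtakeNew]
    constructor
    · rintro (h | ⟨γ, h⟩)
      · exact .inl h
      · by_cases hγ : γ = α
        · subst hγ
          simp only [Function.update_self, Finset.mem_insert] at h
          rcases h with h | h | h
          exacts [.inl ⟨_, h⟩, .inl ⟨_, h⟩, .inr ⟨_, h⟩]
        · rw [Function.update_of_ne hγ] at h
          exact .inr ⟨_, h⟩
    · rintro (h | ⟨γ, h⟩)
      · exact .inl h
      · refine .inr ⟨γ, ?_⟩
        by_cases hγ : γ = α
        · subst hγ; simp [h]
        · rwa [Function.update_of_ne hγ]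
  have hr := root_congr hf
  have hα := L.graft (ℓ' := (s.overtakeNew α u v t (d + 1)).label)
    (st' := (s.overtakeNew α u v t (d + 1)).struct α) (w := t) hM
    (Branch.pair s.self_mem_root hvR htR ht hM (S := {v, t}) (A := {(v, t)}) (by simp) (by simp))
    (fun x hx h => by
      rcases (by simpa using h : x = v ∨ x = t) with rfl | rfl
      exacts [hvS _ hx, htS _ hx])
    hu huv (fun a => label_le_of_isDistance I hu hd) hlt
    (fun x y h _ _ => by
      obtain ⟨rfl, rfl⟩ := (by simpa using h : x = v ∧ y = t)
      omega)
    (fun x => by simp [PhaseState.overtakeNew]; tauto)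
    (fun x y => by simp [PhaseState.overtakeNew]; tauto)
    (by simp [PhaseState.overtakeNew])
    (fun a ha => by simp [PhaseState.overtakeNew, ha])
    (by simp [PhaseState.overtakeNew]) (by simp)
    ⟨v, t, by simp, by
      rw [hvR, htR]; simpa using G.ne_of_adj (M.adj_sub ht), ht, rfl⟩
    (fun x y x' y' h1 h2 h3 h4 _ _ h5 h6 => by
      obtain ⟨hx, hy⟩ := (by simpa using h1 : x = v ∧ y = t)
      obtain ⟨hx', hy'⟩ := (by simpa using h2 : x' = v ∧ y' = t)
      subst hx hy hx' hy'
      rcases Relation.ReflTransGen.cases_tail h5 with h7 | ⟨W, -, h7⟩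
      · exact absurd h7 h4
      · obtain ⟨a, b, h8, h9, -, h10⟩ := h7.exists_arc
        obtain ⟨rfl, rfl⟩ := Prod.mk.inj (Finset.mem_singleton.1 h8)
        exact absurd h10.symm h9)
  have hγ : ∀ γ, γ ≠ α → _ := fun γ hγ => I.live_congr (s' := s.overtakeNew α u v t (d + 1))
    (α := γ) (Function.update_of_ne hγ _ _) (fun x _ => by rw [hr])
    (fun a ha => Function.update_of_ne (fun h : a = (v, t) => hno γ (h ▸ ha)) _ _)
  refine ⟨I.of_family hf ?_ ?_ ?_, ?_⟩
  · intro γ B hB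
    by_cases h : γ = α
    · subst h
      simp only [PhaseState.overtakeNew, Function.update_self, Finset.mem_insert] at hB ⊢
      rcases hB with rfl | rfl | hB
      · simp
      · simp
      · exact fun x hx => by simp [I.sub _ _ hB hx]
    · simp only [PhaseState.overtakeNew, Function.update_of_ne h] at hB ⊢
      exact I.sub _ _ hB
  · have hx : ∀ γ x, x ∈ ((s.overtakeNew α u v t (d + 1)).struct γ).verts →
        x ∈ (s.struct γ).verts ∨ γ = α ∧ (x = v ∨ x = t) := by
      intro γ x hx
      by_cases h : γ = α
      · subst h
        simp only [PhaseState.overtakeNew, Function.update_self, Finset.mem_insert] at hx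
        tauto
      · simp only [PhaseState.overtakeNew, Function.update_of_ne h] at hx
        exact .inl hx
    intro γ δ x h h'
    rcases hx _ _ h with h1 | ⟨h1, h2⟩ <;> rcases hx _ _ h' with h3 | ⟨h3, h4⟩
    · exact I.disj _ _ _ h1 h3
    · rcases h4 with rfl | rfl
      exacts [absurd h1 (hvS _), absurd h1 (htS _)]
    · rcases h2 with rfl | rfl
      exacts [absurd h3 (hvS _), absurd h3 (htS _)]
    · rw [h1, h3]
  · intro γ
    by_cases h : γ = α
    · subst h; exact .inr hα.1
    · exact hr ▸ (hγ γ h).1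
  · rintro a ⟨γ, ha⟩
    by_cases h : γ = α
    · subst h
      rw [hr] at ha
      rcases hα.2 a ha with h | ⟨h, -⟩
      · exact .inr ⟨γ, h⟩
      · exact .inl (by simpa using h)
    · exact .inr ⟨γ, (hγ γ h).2 a ha⟩

theorem Inv.overtakeSame (I : Inv M s) (hM : M.IsMatching)
    (hu : (s.struct α).working = some (s.root u)) (huv : ¬ M.Adj u v) (ht : M.Adj v t)
    (hd : s.IsDistance M u d) (hlt : d + 1 < s.label (v, t))
    (hpv : (p, v) ∈ (s.struct α).arcs) (hm : ¬ M.Adj p v) (hc : s.root p ≠ s.root v) :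
    Inv M (s.overtakeSame α u v t p (d + 1)) ∧
      activeArcs M (s.overtakeSame α u v t p (d + 1)) ⊆ insert (v, t) (activeArcs M s) := by
  have L := I.live_of_working hu
  have hdist := fun a => label_le_of_isDistance (a := a) I hu hd
  have hnb := L.not_below_working hM hu hpv hc hm ht hdist hlt
  have B := subtree_branch L hM hpv hc hm ht
  have hvA := (L.tree.arc_of_inner hM hpv hc hm ht).1
  have hf : ∀ B, B ∈ (s.overtakeSame α u v t p (d + 1)).family ↔ B ∈ s.family := by
    intro B
    simp only [mem_family, PhaseState.overtakeSame]
    refine or_congr_right (exists_congr fun γ => ?_)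
    by_cases hγ : γ = α
    · subst hγ; simp
    · rw [Function.update_of_ne hγ]
  have hr := root_congr hf
  -- Reattachment is a cut followed by a graft. The intermediate structure is auxiliary, and its
  -- empty blossom family is harmless because `Live` does not look at blossoms.
  obtain ⟨L₁, hL₁⟩ := L.shrink (ℓ' := s.label)
    (st' := ⟨(s.struct α).verts \ s.subtree α v, s.restArcs α v, ∅, (s.struct α).working⟩)
    (L.tree.cut_rest hpv hc hm (fun x => by
      rw [Finset.mem_sdiff, mem_subtree]; tauto) (fun _ _ => mem_restArcs))
    restArcs_subset (fun _ _ => rfl) (fun W' h => by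
      obtain rfl : s.root u = W' := by simpa [hu] using h
      exact ⟨AltTree.cut_out (fun _ _ => mem_restArcs) (L.out _ hu) hnb, _, hu, .refl⟩)
  have hα := L₁.graft (ℓ' := (s.overtakeSame α u v t p (d + 1)).label)
    (st' := (s.overtakeSame α u v t p (d + 1)).struct α) (w := t) hM B
    (fun x hx h => (Finset.mem_sdiff.1 hx).2 h)
    hu huv (fun a ha => hdist a (hL₁ a ha)) hlt
    (fun x y h => L.pos _ _ (subtreeArcs_subset h))
    (fun x => by
      have := fun h : x ∈ s.subtree α v => (mem_subtree.1 h).1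
      simp only [PhaseState.overtakeSame, Function.update_self, Finset.mem_sdiff]
      tauto)
    (fun x y => by
      simp only [← or_assoc, rest_or_subtree L.tree hpv hc]
      simp only [PhaseState.overtakeSame, Function.update_self, Finset.mem_insert,
        Finset.mem_erase, Prod.mk.injEq]
      tauto)
    (by simp [PhaseState.overtakeSame])
    (fun a ha => by simp [PhaseState.overtakeSame, ha])
    (by simp [PhaseState.overtakeSame]) (B.ends _ _ B.arc).2
    ⟨v, t, B.arc, B.cross, ht, rfl⟩
    (fun x y x' y' h1 h2 h3 h4 _ _ h5 h6 => absurd h6 (B.not_anc_tip h1 h2 h3 h4 h5))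
  have hγ : ∀ γ, γ ≠ α → _ := fun γ hγ => I.live_congr
    (s' := s.overtakeSame α u v t p (d + 1))
    (α := γ) (Function.update_of_ne hγ _ _) (fun x _ => by rw [hr])
    (fun a ha => Function.update_of_ne (fun h : a = (v, t) => hγ (I.disj _ _ v
      ((I.live_of_arc ha).tree.ends v t (h ▸ ha)).1 (L.tree.ends _ _ hvA).1)) _ _)
  have hsame : ∀ γ, ((s.overtakeSame α u v t p (d + 1)).struct γ).verts = (s.struct γ).verts ∧
      ((s.overtakeSame α u v t p (d + 1)).struct γ).blossoms = (s.struct γ).blossoms := by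
    intro γ
    by_cases h : γ = α
    · subst h; simp [PhaseState.overtakeSame]
    · simp [PhaseState.overtakeSame, Function.update_of_ne h]
  refine ⟨I.of_family hf ?_ ?_ ?_, ?_⟩
  · intro γ B
    rw [(hsame γ).1, (hsame γ).2]
    exact I.sub γ B
  · intro γ δ x
    rw [(hsame γ).1, (hsame δ).1]
    exact I.disj γ δ x
  · intro γ
    by_cases h : γ = α
    · subst h; exact .inr hα.1
    · exact hr ▸ (hγ γ h).1
  · rintro a ⟨γ, ha⟩
    by_cases h : γ = α
    · subst h
      rw [hr] at ha
      rcases hα.2 a ha with h | ⟨h, h1, -, h2⟩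
      · exact .inr ⟨γ, hL₁ a h⟩
      · obtain ⟨h3, h4⟩ := B.eq_arc_of_anc (x := a.1) (y := a.2) h h1 h2
        exact .inl (Prod.ext h3 h4)
    · exact .inr ⟨γ, (hγ γ h).2 a ha⟩

/-- The branch is cut from `β` and grafted onto `α`. If the working vertex of `β` was in the branch,
the lower part of its active path passes to `α`, so the union of all active paths can gain only `(v,
t)`. -/
theorem Inv.overtakeOther (I : Inv M s) (hM : M.IsMatching)
    (hu : (s.struct α).working = some (s.root u)) (huv : ¬ M.Adj u v) (ht : M.Adj v t)
    (hd : s.IsDistance M u d) (hlt : d + 1 < s.label (v, t)) (hβ : β ≠ α)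
    (hpv : (p, v) ∈ (s.struct β).arcs) (hm : ¬ M.Adj p v) (hc : s.root p ≠ s.root v) :
    Inv M (s.overtakeOther α β u v t p (d + 1)) ∧
      activeArcs M (s.overtakeOther α β u v t p (d + 1)) ⊆ insert (v, t) (activeArcs M s) := by
  have L := I.live_of_working hu
  have Lβ := I.live_of_arc hpv
  have T := Lβ.tree
  have Br := subtree_branch Lβ hM hpv hc hm ht
  have hdist := fun a => label_le_of_isDistance (a := a) I hu hd
  obtain ⟨hvA, hvc⟩ := T.arc_of_inner hM hpv hc hm ht
  have hsub : s.subtree β v ⊆ (s.struct β).verts := fun x hx => (mem_subtree.1 hx).1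
  -- The subtree is a union of classes, so a blossom not contained in it is disjoint from it.
  have hcl : ∀ B ∈ (s.struct β).blossoms, ¬ B ⊆ s.subtree β v → ∀ x ∈ B, x ∉ s.subtree β v := by
    intro B hB hn x hx h
    refine hn fun y hy => mem_subtree.2 ⟨I.sub _ _ hB hy, ?_⟩
    rw [I.lam B (mem_family.2 (.inr ⟨_, hB⟩)) y hy x hx]
    exact (mem_subtree.1 h).2
  obtain ⟨s', hs'⟩ : ∃ s', s' = s.overtakeOther α β u v t p (d + 1) := ⟨_, rfl⟩
  rw [← hs']
  have hstα : s'.struct α =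
      { verts := (s.struct α).verts ∪ s.subtree β v
        arcs := insert (u, v) ((s.struct α).arcs ∪ (s.struct β).arcs.filter fun a =>
          a.1 ∈ s.subtree β v ∧ a.2 ∈ s.subtree β v)
        blossoms := (s.struct α).blossoms ∪
          (s.struct β).blossoms.filter fun B => B ⊆ s.subtree β v
        working := if s.WorkingBelow β t then (s.struct β).working else some (s.root t) } := by
    rw [hs']
    simp only [PhaseState.overtakeOther, Function.update_self]
  have hstβ : s'.struct β =
      { verts := (s.struct β).verts \ s.subtree β v
        arcs := ((s.struct β).arcs.erase (p, v)).filter fun a =>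
          ¬ (a.1 ∈ s.subtree β v ∧ a.2 ∈ s.subtree β v)
        blossoms := (s.struct β).blossoms.filter fun B => ¬ B ⊆ s.subtree β v
        working := if s.WorkingBelow β t then some (s.root p) else (s.struct β).working } := by
    rw [hs']
    exact (Function.update_of_ne hβ _ _).trans (Function.update_self ..)
  have hst : ∀ γ, γ ≠ α → γ ≠ β → s'.struct γ = s.struct γ := fun γ h h' => by
    rw [hs']
    exact (Function.update_of_ne h _ _).trans (Function.update_of_ne h' _ _)
  have hℓ : s'.label (v, t) = d + 1 := by rw [hs']; simp only [PhaseState.overtakeOther, Function.update_self]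
  have hℓ' : ∀ a, a ≠ (v, t) → s'.label a = s.label a := fun a ha => by
    rw [hs']; exact Function.update_of_ne ha _ _
  clear hs'
  have hf : ∀ B, B ∈ s'.family ↔ B ∈ s.family := by
    intro B
    simp only [mem_family]
    refine or_congr_right ⟨?_, ?_⟩
    · rintro ⟨γ, h⟩
      by_cases hγ : γ = α
      · subst hγ
        simp only [hstα, Finset.mem_union, Finset.mem_filter] at h
        rcases h with h | h
        exacts [⟨_, h⟩, ⟨_, h.1⟩]
      · by_cases hγ' : γ = β
        · subst hγ'
          simp only [hstβ, Finset.mem_filter] at h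
          exact ⟨_, h.1⟩
        · rw [hst γ hγ hγ'] at h
          exact ⟨_, h⟩
    · rintro ⟨γ, h⟩
      by_cases hγ : γ = α
      · subst hγ
        exact ⟨γ, by simp [hstα, h]⟩
      · by_cases hγ' : γ = β
        · subst hγ'
          by_cases hB : B ⊆ s.subtree γ v
          · exact ⟨α, by simp [hstα, h, hB]⟩
          · exact ⟨γ, by simp [hstβ, h, hB]⟩
        · exact ⟨γ, by rwa [hst γ hγ hγ']⟩
  have hr := root_congr hf
  have hβ' : Live M s.root s'.label β (s'.struct β) ∧
      ∀ a, OnPath M s.root (s'.struct β) a → OnPath M s.root (s.struct β) a := by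
    have hmem : ∀ x y, (x, y) ∈ (s'.struct β).arcs ↔ (x, y) ∈ s.restArcs β v := fun x y => by
      rw [mem_restArcs_iff T hpv hc, hstβ]
      simp only [Finset.mem_filter, Finset.mem_erase]
      tauto
    have hmem' := fun x y => (hmem x y).trans mem_restArcs
    refine Lβ.shrink (T.cut_rest hpv hc hm (fun x => ?_) hmem')
      (fun a ha => ((hmem' a.1 a.2).1 ha).1) (fun a ha => hℓ' a ?_) (fun W' h => ?_)
    · rw [hstβ, Finset.mem_sdiff, mem_subtree]; tauto
    · rintro rfl
      exact ((hmem' _ _).1 ha).2 (ClassArc.anc hvA hvc)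
    · by_cases hb : s.WorkingBelow β t
      · obtain ⟨W, hW, htW⟩ := hb
        obtain rfl : s.root p = W' := by
          simpa [hstβ, show s.WorkingBelow β t from ⟨W, hW, htW⟩] using h
        exact ⟨AltTree.cut_out hmem' (T.unm _ _ hpv hc hm).2.2 (T.not_below_parent hpv hc),
          W, hW, (Relation.ReflTransGen.head (ClassArc.mk hpv hc)
            (.head (ClassArc.mk hvA hvc) htW))⟩
      · have hW : (s.struct β).working = some W' := by simpa [hstβ, hb] using h
        -- The working vertex is outer and `v` is inner, so being below `v` would mean being below
        -- `t`. Hence this working vertex survives the cut.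
        refine ⟨AltTree.cut_out hmem' (Lβ.out _ hW) fun h1 => hb ⟨W', hW, ?_⟩, W', hW, .refl⟩
        exact T.anc_child hM hpv hc hm ht h1 fun h2 => T.not_out hpv hc hm (h2 ▸ Lβ.out _ hW)
  -- A representative `w` of the new working vertex of `α`: the head of the matched arc entering the
  -- old working vertex of `β` if that is inherited, and `t` otherwise.
  obtain ⟨w, hW, hw, hout, hincr, hpath⟩ : ∃ w, (s'.struct α).working = some (s.root w) ∧
      w ∈ s.subtree β v ∧
      (∃ x y, (x, y) ∈ s.subtreeArcs β v ∧ s.root x ≠ s.root y ∧ M.Adj x y ∧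
        s.root y = s.root w) ∧
      (∀ x y x' y', (x, y) ∈ s.subtreeArcs β v → (x', y') ∈ s.subtreeArcs β v →
        s.root x ≠ s.root y → s.root x' ≠ s.root y' → M.Adj x y → M.Adj x' y' →
        Anc s.root (s.subtreeArcs β v) (s.root y) (s.root x') →
        Anc s.root (s.subtreeArcs β v) (s.root y') (s.root w) →
        s.label (x, y) < s.label (x', y')) ∧
      ∀ x y, (x, y) ∈ s.subtreeArcs β v → s.root x ≠ s.root y → M.Adj x y →
        Anc s.root (s.subtreeArcs β v) (s.root y) (s.root w) →
        (x, y) = (v, t) ∨ OnPath M s.root (s.struct β) (x, y) := by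
    by_cases hb : s.WorkingBelow β t
    · obtain ⟨W, hW, htW⟩ := hb
      have htW' : Anc s.root (s.struct β).arcs (s.root t) W := htW
      rcases Lβ.out W hW with h1 | ⟨x, y, h1, h2, h3, rfl⟩
      · exact absurd (T.eq_root_of_anc (h1 ▸ htW')) (T.top _ _ hvA hvc)
      · have hvy := htW'.head (ClassArc.mk hvA hvc)
        have hxy : (x, y) ≠ (p, v) := by rintro ⟨⟩; exact hm h3
        refine ⟨y, by simpa [hstα, show s.WorkingBelow β t from ⟨_, hW, htW⟩] using hW,
          mem_subtree.2 ⟨(T.ends _ _ h1).2, hvy⟩,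
          ⟨x, y, mem_subtreeArcs.2 ⟨h1, T.tail_below hpv hc h1 hvy hxy⟩, h2, h3, rfl⟩,
          fun a b a' b' h4 h5 h6 h7 h8 h9 h10 h11 => ?_, fun a b h4 h5 h6 h7 => .inr ?_⟩
        · exact Lβ.incr _ hW _ _ _ _ (subtreeArcs_subset h4) (subtreeArcs_subset h5) h6 h7 h8 h9
            (h10.mono subtreeArcs_subset) (h11.mono subtreeArcs_subset)
        · exact ⟨_, hW, subtreeArcs_subset h4, h5, h6, h7.mono subtreeArcs_subset⟩
    · refine ⟨t, by simp [hstα, hb], (Br.ends _ _ Br.arc).2, ⟨v, t, Br.arc, Br.cross, ht, rfl⟩,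
        fun x y x' y' h1 h2 h3 h4 _ _ h5 h6 => absurd h6 (Br.not_anc_tip h1 h2 h3 h4 h5),
        fun x y h1 h2 _ h3 => .inl ?_⟩
      obtain ⟨rfl, rfl⟩ := Br.eq_arc_of_anc h1 h2 h3
      rfl
  have hα := L.graft (ℓ' := s'.label) (st' := s'.struct α) (w := w) hM Br
    (fun x hx h => hβ (I.disj _ _ _ (hsub h) hx)) hu huv hdist hlt
    (fun x y h => Lβ.pos _ _ (subtreeArcs_subset h))
    (fun x => by rw [hstα, Finset.mem_union])
    (fun x y => by
      rw [mem_subtreeArcs_iff T, hstα]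
      simp only [Finset.mem_insert, Finset.mem_union, Finset.mem_filter, Prod.mk.injEq]
      tauto)
    hℓ hℓ' hW hw hout hincr
  have hγ : ∀ γ, γ ≠ α → γ ≠ β → _ := fun γ hγ hγ' => I.live_congr
    (s' := s') (α := γ) (hst γ hγ hγ') (fun x _ => by rw [hr])
    (fun a ha => hℓ' a (fun h => hγ' (I.disj _ _ v
      ((I.live_of_arc ha).tree.ends v t (h ▸ ha)).1 (T.ends _ _ hvA).1)))
  refine ⟨I.of_family hf ?_ ?_ ?_, ?_⟩
  · intro γ B hB
    by_cases h : γ = α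
    · subst h
      rw [hstα] at hB ⊢
      simp only [Finset.mem_union, Finset.mem_filter] at hB
      rcases hB with hB | hB
      · exact (I.sub _ _ hB).trans Finset.subset_union_left
      · exact hB.2.trans Finset.subset_union_right
    · by_cases h' : γ = β
      · subst h'
        rw [hstβ] at hB ⊢
        simp only [Finset.mem_filter] at hB
        exact fun x hx => Finset.mem_sdiff.2 ⟨I.sub _ _ hB.1 hx, hcl _ hB.1 hB.2 x hx⟩
      · rw [hst γ h h'] at hB ⊢
        exact I.sub _ _ hB
  · have hx : ∀ γ x, x ∈ (s'.struct γ).verts →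
        (x ∈ (s.struct γ).verts ∧ x ∉ s.subtree β v) ∨ γ = α ∧ x ∈ s.subtree β v := by
      intro γ x hx
      by_cases h : γ = α
      · subst h
        rw [hstα, Finset.mem_union] at hx
        tauto
      · by_cases h' : γ = β
        · subst h'
          rw [hstβ, Finset.mem_sdiff] at hx
          exact .inl hx
        · rw [hst γ h h'] at hx
          exact .inl ⟨hx, fun h1 => h' (I.disj _ _ _ hx (hsub h1))⟩
    intro γ δ x h h'
    rcases hx _ _ h with h | h <;> rcases hx _ _ h' with h' | h'
    · exact I.disj _ _ _ h.1 h'.1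
    · exact absurd h'.2 h.2
    · exact absurd h.2 h'.2
    · rw [h.1, h'.1]
  · intro γ
    by_cases h : γ = α
    · subst h; exact .inr hα.1
    · by_cases h' : γ = β
      · subst h'; exact .inr hβ'.1
      · exact hr ▸ (hγ γ h h').1
  · rintro a ⟨γ, ha⟩
    by_cases h : γ = α
    · subst h
      rw [hr] at ha
      rcases hα.2 a ha with h | ⟨h, h1, h2, h3⟩
      · exact .inr ⟨γ, h⟩
      · rcases hpath a.1 a.2 h h1 h2 h3 with h | h
        · exact .inl h
        · exact .inr ⟨β, h⟩
    · by_cases h' : γ = β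
      · subst h'
        rw [hr] at ha
        exact .inr ⟨γ, hβ'.2 a ha⟩
      · exact .inr ⟨γ, (hγ γ h h').2 a ha⟩

end Overtake

end PhaseState

/-! ### The potential and the cost of each operation -/

namespace PhaseState

theorem isActive_update {st : V → FreeStructure V} {α γ : V} {x : FreeStructure V}
    (h : (Function.update st α x γ).working ≠ none) (hα : (st α).working ≠ none) :
    (st γ).working ≠ none := by
  by_cases hγ : γ = α
  · subst hγ; exact hα
  · rwa [Function.update_of_ne hγ] at h

variable [Fintype V] {s s' s'' : PhaseState V}

/-- The arcs of the matching. -/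
noncomputable def matchedArcs (M : G.Subgraph) : Finset (V × V) :=
  Finset.univ.filter fun a => M.Adj a.1 a.2

theorem mem_matchedArcs {a : V × V} : a ∈ matchedArcs M ↔ M.Adj a.1 a.2 := by
  simp [matchedArcs]

/-- The quantity that pays for the operations and for the backtracking. -/
noncomputable def potential (M : G.Subgraph) (s : PhaseState V) : ℕ :=
  3 * ∑ a ∈ matchedArcs M, s.label a + (activeArcs M s).ncard

/-- The active structures that are marked as modified. -/
noncomputable def activeModified (M : G.Subgraph) (s : PhaseState V) : Finset V :=
  Finset.univ.filter fun α => s.IsActive M α ∧ α ∈ s.modified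

theorem mem_activeModified {α : V} :
    α ∈ activeModified M s ↔ s.IsActive M α ∧ α ∈ s.modified := by
  simp [activeModified]

/-- The effect of the operations of a pass-bundle before backtracking. -/
structure Progress (M : G.Subgraph) (s s' : PhaseState V) : Prop where
  inv : Inv M s'
  le : potential M s' + (activeModified M s').card ≤ potential M s + (activeModified M s).card
  onHold : s'.onHold = s.onHold
  active : ∀ α, s'.IsActive M α → s.IsActive M α

theorem Inv.progress_refl (I : Inv M s) : Progress M s s := ⟨I, le_rfl, rfl, fun _ h => h⟩

theorem Progress.trans (h : Progress M s s') (h' : Progress M s' s'') : Progress M s s'' :=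
  ⟨h'.inv, h'.le.trans h.le, h'.onHold.trans h.onHold, fun α h1 => h.active α (h'.active α h1)⟩

/-- The weight 3 is spent here: one unit for the possible new active arc `b`, two for the structures
`α` and `β` that may become modified. -/
theorem progress_of_label_lt {α β : V} {b : V × V} (I : Inv M s')
    (hact : activeArcs M s' ⊆ insert b (activeArcs M s)) (hle : ∀ a, s'.label a ≤ s.label a)
    (hlt : ∃ a : V × V, M.Adj a.1 a.2 ∧ s'.label a < s.label a)
    (hmod : s'.modified ⊆ insert β (insert α s.modified)) (hhold : s'.onHold = s.onHold)
    (ha : ∀ α, s'.IsActive M α → s.IsActive M α) : Progress M s s' := by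
  refine ⟨I, ?_, hhold, ha⟩
  have h1 : ∑ a ∈ matchedArcs M, s'.label a < ∑ a ∈ matchedArcs M, s.label a := by
    obtain ⟨a, h1, h2⟩ := hlt
    exact Finset.sum_lt_sum (fun a _ => hle a) ⟨a, mem_matchedArcs.2 h1, h2⟩
  have h2 : (activeArcs M s').ncard ≤ (activeArcs M s).ncard + 1 :=
    (Set.ncard_le_ncard hact (Set.toFinite _)).trans (Set.ncard_insert_le _ _)
  have h3 : (activeModified M s').card ≤ (activeModified M s).card + 2 := by
    have hsub : activeModified M s' ⊆ insert β (insert α (activeModified M s)) := fun γ hγ => by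
      rw [mem_activeModified] at hγ
      rw [Finset.mem_insert, Finset.mem_insert, mem_activeModified]
      exact (hmod hγ.2).imp id (.imp id fun h => ⟨ha _ hγ.1, h⟩)
    have h4 := Finset.card_le_card hsub
    have h5 := Finset.card_insert_le β (insert α (activeModified M s))
    have h6 := Finset.card_insert_le α (activeModified M s)
    omega
  unfold potential
  omega

theorem Inv.contract_progress (I : Inv M s) (hM : M.IsMatching) {α u v : V}
    (hu : (s.struct α).working = some (s.root u)) (hv : s.IsOuter α (s.root v))
    (huv : s.root u ≠ s.root v) : Progress M s (s.contract M α u v) := by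
  obtain ⟨I', hact⟩ := I.contract hM hu hv
  refine progress_of_label_lt (α := α) (β := α) (b := (u, v)) I'
    (hact.trans (Set.subset_insert _ _)) ?_ (exists_label_contract I hu hv huv) ?_ rfl ?_
  · intro a
    simp only [PhaseState.contract]
    split_ifs <;> omega
  · simp [PhaseState.contract]
  · exact fun γ h => ⟨h.1, isActive_update h.2 (by simp [hu])⟩

/-- The two structures marked as modified are no longer active, so no label has to fall to pay for
them. -/
theorem Inv.augment_progress (I : Inv M s) {α β : V} (p : List V) :
    Progress M s (s.augment α β p) := by
  obtain ⟨I', hact⟩ := I.augment (α := α) (β := β) p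
  have ha : ∀ γ, (s.augment α β p).IsActive M γ → s.IsActive M γ ∧ γ ≠ α ∧ γ ≠ β := by
    rintro γ ⟨h1, h2⟩
    simp only [PhaseState.augment] at h2
    by_cases hβ : γ = β
    · subst hβ; simp [FreeStructure.empty] at h2
    · rw [Function.update_of_ne hβ] at h2
      by_cases hα : γ = α
      · subst hα; simp [FreeStructure.empty] at h2
      · rw [Function.update_of_ne hα] at h2
        exact ⟨⟨h1, h2⟩, hα, hβ⟩
  refine ⟨I', add_le_add (Nat.add_le_add_left (Set.ncard_le_ncard hact (Set.toFinite _)) _)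
    (Finset.card_le_card fun γ hγ => ?_), rfl, fun γ h => (ha γ h).1⟩
  rw [mem_activeModified] at hγ ⊢
  obtain ⟨h1, h2, h3⟩ := ha γ hγ.1
  refine ⟨h1, hγ.2.resolve_right ?_⟩
  simp [h2, h3]

theorem Inv.overtake_progress (I : Inv M s) (hM : M.IsMatching) {α u v t : V} {d : ℕ}
    (hu : (s.struct α).working = some (s.root u)) (huv : ¬ M.Adj u v) (ht : M.Adj v t)
    (hv : ¬ ∃ β, s.IsOuter β (s.root v)) (hd : s.IsDistance M u d) (hlt : d + 1 < s.label (v, t))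
    (h : s.Overtake M α u v t (d + 1) s') : Progress M s s' := by
  have hle : ∀ a, Function.update s.label (v, t) (d + 1) a ≤ s.label a := by
    intro a
    by_cases ha : a = (v, t)
    · subst ha; rw [Function.update_self]; exact hlt.le
    · rw [Function.update_of_ne ha]
  have hlt' : ∃ a : V × V, M.Adj a.1 a.2 ∧
      Function.update s.label (v, t) (d + 1) a < s.label a :=
    ⟨(v, t), ht, by rwa [Function.update_self]⟩
  have hα : (s.struct α).working ≠ none := by simp [hu]
  cases h with
  | fresh hno =>
    obtain ⟨I', hact⟩ := I.overtakeNew hM hu huv ht hv hd hlt hno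
    exact progress_of_label_lt (α := α) (β := α) I' hact hle hlt' (by simp [PhaseState.overtakeNew])
      rfl fun γ h => ⟨h.1, isActive_update h.2 hα⟩
  | same p _ hpv hm hc =>
    obtain ⟨I', hact⟩ := I.overtakeSame hM hu huv ht hd hlt hpv hm hc
    exact progress_of_label_lt (α := α) (β := α) I' hact hle hlt'
      (by simp [PhaseState.overtakeSame]) rfl fun γ h => ⟨h.1, isActive_update h.2 hα⟩
  | other β p hβ _ hpv hm hc =>
    obtain ⟨I', hact⟩ := I.overtakeOther hM hu huv ht hd hlt hβ hpv hm hc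
    refine progress_of_label_lt (α := α) (β := β) I' hact hle hlt'
      (by simp [PhaseState.overtakeOther]) rfl fun γ h => ⟨h.1, ?_⟩
    by_cases hγ : γ = α
    · subst hγ; exact hα
    · have h2 := h.2
      simp only [PhaseState.overtakeOther, Function.update_of_ne hγ] at h2
      by_cases hγ' : γ = β
      · subst hγ'
        simp only [Function.update_self] at h2
        split_ifs at h2 with hb
        · obtain ⟨W, hW, -⟩ := hb
          simp [hW]
        · exact h2
      · rwa [Function.update_of_ne hγ'] at h2

theorem Inv.extendStep_progress (I : Inv M s) (hM : M.IsMatching) {a : V × V}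
    (h : s.ExtendStep M a s') : Progress M s s' := by
  rcases h with h | ⟨-, rfl⟩
  · cases h with
    | contract α h hv => exact I.contract_progress hM h.2.2.2.1 hv h.2.2.1
    | augment α β p => exact I.augment_progress p
    | overtake α t d s' h hv ht hd hlt ho =>
      exact I.overtake_progress hM h.2.2.2.1 h.2.2.2.2.1 ht hv hd hlt ho
  · exact I.progress_refl

theorem Inv.augmentStep_progress (I : Inv M s) {a : V × V} (h : s.AugmentStep M a s') :
    Progress M s s' := by
  rcases h with ⟨α, β, p, -, -, -, -, rfl⟩ | ⟨-, rfl⟩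
  · exact I.augment_progress p
  · exact I.progress_refl

theorem Inv.pass_progress {step : PhaseState V → V × V → PhaseState V → Prop}
    (hstep : ∀ s a s', Inv M s → step s a s' → Progress M s s') {L : List (V × V)} (I : Inv M s)
    (h : Pass step s L s') : Progress M s s' := by
  induction h with
  | nil => exact I.progress_refl
  | cons h _ ih =>
    have h1 := hstep _ _ _ I h
    exact h1.trans (ih h1.inv)

theorem Inv.contractAll_progress (I : Inv M s) (hM : M.IsMatching)
    (h : Relation.ReflTransGen (ContractStep M) s s') : Progress M s s' := by
  induction h with
  | refl => exact I.progress_refl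
  | tail _ h ih =>
    obtain ⟨α, u, v, -, -, -, hu, huv, hv, rfl⟩ := h
    exact ih.trans (ih.inv.contract_progress hM hu hv huv.symm)

/-! ### Backtracking -/

/-- The grandparent of an outer vertex is reached by going up a matched and then an unmatched arc.
It is outer again, and the matched arc entering `W` falls off the active path. -/
theorem backtrackFrom_spec {α : V} {W Y : Finset V}
    (T : AltTree M s.root α (s.struct α).verts (s.struct α).arcs)
    (hW : Out M s.root α (s.struct α).arcs W) (h : s.backtrackFrom α W = some Y) :
    Out M s.root α (s.struct α).arcs Y ∧ Anc s.root (s.struct α).arcs Y W ∧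
      ∃ a ∈ (s.struct α).arcs, s.root a.1 ≠ s.root a.2 ∧ M.Adj a.1 a.2 ∧ s.root a.2 = W ∧
        ¬ Anc s.root (s.struct α).arcs (s.root a.2) Y := by
  unfold backtrackFrom at h
  split_ifs at h with hY
  obtain ⟨hn, X, h1, h2⟩ := hY.choose_spec
  rw [Option.some.inj h] at h1
  rcases hW with hW | ⟨x, y, h3, h4, h5, rfl⟩
  · exact absurd hW hn
  obtain rfl := T.parent_unique (ClassArc.mk h3 h4) h2
  obtain ⟨-, p, h6, h7, h8⟩ := T.mat _ _ h3 h4 h5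
  obtain rfl := T.parent_unique (ClassArc.mk h6 h7) h1
  have hxy := ClassArc.anc h3 h4
  have hpx := ClassArc.anc h6 h7
  exact ⟨(T.unm _ _ h6 h7 h8).2.2, hpx.trans hxy, (x, y), h3, h4, h5, rfl, fun h9 =>
    h7 (T.acyclic (T.ends _ _ h6).2 (hxy.trans h9) hpx)⟩

theorem Inv.backtrack (I : Inv M s) : Inv M s.backtrack ∧
    (∀ α, s.backtrack.IsActive M α → s.IsActive M α) ∧
    potential M s.backtrack + (Finset.univ.filter fun α => s.backtrack.IsActive M α ∧
      α ∉ s.onHold ∧ α ∉ s.modified).card ≤ potential M s := by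
  have hverts : ∀ γ, (s.backtrack.struct γ).verts = (s.struct γ).verts ∧
      (s.backtrack.struct γ).arcs = (s.struct γ).arcs ∧
      (s.backtrack.struct γ).blossoms = (s.struct γ).blossoms := by
    intro γ
    simp only [PhaseState.backtrack]
    split_ifs <;> exact ⟨rfl, rfl, rfl⟩
  have hkeep : ∀ γ, γ ∈ s.onHold ∨ γ ∈ s.modified → s.backtrack.struct γ = s.struct γ :=
    fun γ h => if_pos h
  have hback : ∀ γ, ¬ (γ ∈ s.onHold ∨ γ ∈ s.modified) → ∀ Y,
      (s.backtrack.struct γ).working = some Y →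
        ∃ W, (s.struct γ).working = some W ∧ s.backtrackFrom γ W = some Y := by
    intro γ h Y hY
    simp only [PhaseState.backtrack, if_neg h] at hY
    exact Option.bind_eq_some_iff.1 hY
  have hf : ∀ B, B ∈ s.backtrack.family ↔ B ∈ s.family := by
    intro B
    simp only [mem_family, (hverts _).2.2]
  have hr := root_congr hf
  have hact : ∀ γ, s.backtrack.IsActive M γ → s.IsActive M γ := by
    rintro γ ⟨h1, h2⟩
    refine ⟨h1, ?_⟩
    by_cases h : γ ∈ s.onHold ∨ γ ∈ s.modified
    · rwa [hkeep γ h] at h2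
    · obtain ⟨Y, hY⟩ := Option.ne_none_iff_exists'.1 h2
      obtain ⟨W, hW, -⟩ := hback γ h Y hY
      simp [hW]
  have hlive : ∀ γ, (s.backtrack.struct γ = FreeStructure.empty V ∨
      Live M s.root s.label γ (s.backtrack.struct γ)) ∧
        ∀ a, OnPath M s.root (s.backtrack.struct γ) a → OnPath M s.root (s.struct γ) a := by
    intro γ
    by_cases h : γ ∈ s.onHold ∨ γ ∈ s.modified
    · rw [hkeep γ h]
      exact ⟨I.live γ, fun _ h => h⟩
    · rcases I.live γ with h1 | L
      · refine ⟨.inl ?_, ?_⟩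
        · simp [PhaseState.backtrack, h1, FreeStructure.empty]
        · rintro a ⟨W, -, h2, -⟩
          rw [(hverts γ).2.1, h1] at h2
          simp [FreeStructure.empty] at h2
      · have := L.shrink (ℓ' := s.label) (st' := s.backtrack.struct γ)
          (by rw [(hverts γ).1, (hverts γ).2.1]; exact L.tree) (by rw [(hverts γ).2.1])
          (fun _ _ => rfl) (fun Y hY => by
            obtain ⟨W, hW, hWY⟩ := hback γ h Y hY
            obtain ⟨h2, h3, -⟩ := backtrackFrom_spec L.tree (L.out W hW) hWY
            rw [(hverts γ).2.1]
            exact ⟨h2, W, hW, h3⟩)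
        exact this.imp .inr id
  have hpath : activeArcs M s.backtrack ⊆ activeArcs M s := by
    rintro a ⟨γ, ha⟩
    rw [hr] at ha
    exact ⟨γ, (hlive γ).2 a ha⟩
  refine ⟨I.of_family hf ?_ ?_ fun γ => (hlive γ).1, hact, ?_⟩
  · intro γ B
    rw [(hverts γ).1, (hverts γ).2.2]
    exact I.sub γ B
  · intro γ δ x
    rw [(hverts γ).1, (hverts δ).1]
    exact I.disj γ δ x
  · set D := Finset.univ.filter fun α => s.backtrack.IsActive M α ∧
      α ∉ s.onHold ∧ α ∉ s.modified with hD
    -- Each structure that moves back but stays active is charged to the matched arc entering its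
    -- old working vertex. Disjointness of structures makes the charge injective and keeps the arc
    -- off all other active paths.
    have key : ∀ γ : V, ∃ a : V × V, γ ∈ D →
        a ∈ (s.struct γ).arcs ∧ a ∈ activeArcs M s ∧ a ∉ activeArcs M s.backtrack := by
      intro γ
      by_cases hγ : γ ∈ D
      · obtain ⟨⟨h1, h2⟩, h3, h4⟩ := (Finset.mem_filter.1 hγ).2
        have h5 : ¬ (γ ∈ s.onHold ∨ γ ∈ s.modified) := by tauto
        obtain ⟨Y, hY⟩ := Option.ne_none_iff_exists'.1 h2
        obtain ⟨W, hW, hWY⟩ := hback γ h5 Y hY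
        have L := I.live_of_working hW
        obtain ⟨-, -, a, ha, h6, h7, h8, h9⟩ := backtrackFrom_spec L.tree (L.out W hW) hWY
        refine ⟨a, fun _ => ⟨ha, ⟨γ, W, hW, ha, h6, h7, h8 ▸ .refl⟩, ?_⟩⟩
        rintro ⟨δ, Z, hZ, hZa, -, -, hZ'⟩
        rw [(hverts δ).2.1] at hZa
        obtain rfl := I.disj _ _ a.1 (L.tree.ends a.1 a.2 ha).1
          ((I.live_of_arc hZa).tree.ends a.1 a.2 hZa).1
        obtain rfl := Option.some.inj (hZ.symm.trans hY)
        rw [hr, (hverts γ).2.1] at hZ'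
        exact h9 hZ'
      · exact ⟨(γ, γ), fun h => absurd h hγ⟩
    choose f hf using key
    have hinj : Set.InjOn f D := by
      intro γ hγ δ hδ h
      have h1 := (hf γ hγ).1
      have h2 := (hf δ hδ).1
      rw [h] at h1
      exact I.disj _ _ (f δ).1 ((I.live_of_arc h1).tree.ends (f δ).1 (f δ).2 h1).1
        ((I.live_of_arc h2).tree.ends (f δ).1 (f δ).2 h2).1
    have hdisj : Disjoint (activeArcs M s.backtrack) (f '' D) := by
      rw [Set.disjoint_right]
      rintro _ ⟨γ, hγ, rfl⟩
      exact (hf γ hγ).2.2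
    have hsub : activeArcs M s.backtrack ∪ f '' D ⊆ activeArcs M s := by
      refine Set.union_subset hpath ?_
      rintro _ ⟨γ, hγ, rfl⟩
      exact (hf γ hγ).2.1
    have h1 := Set.ncard_le_ncard hsub (Set.toFinite _)
    rw [Set.ncard_union_eq hdisj (Set.toFinite _) (Set.toFinite _), hinj.ncard_image,
      Set.ncard_coe_finset] at h1
    have h2 : s.backtrack.label = s.label := rfl
    unfold potential
    rw [h2]
    omega

/-! ### Counting active structures after one pass-bundle -/

/-- Structures with at least `6 / h + 1` vertices contain at least `6 / h` matched vertices each. -/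
theorem Inv.card_large_le (I : Inv M s) {h : ℝ} (hh : 0 < h) :
    6 / h * ((Finset.univ.filter fun α : V =>
      6 / h + 1 ≤ ((s.struct α).verts.card : ℝ)).card : ℝ) ≤ ((matchedArcs M).card : ℝ) := by
  set D := Finset.univ.filter fun α : V => 6 / h + 1 ≤ ((s.struct α).verts.card : ℝ) with hD
  have hpos : (0 : ℝ) < 6 / h := by positivity
  have hlive : ∀ α ∈ D, Live M s.root s.label α (s.struct α) := fun α hα => by
    have h1 := (Finset.mem_filter.1 hα).2
    have h2 : (0 : ℝ) < ((s.struct α).verts.card : ℝ) := by linarith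
    obtain ⟨x, hx⟩ := Finset.card_pos.1 (by exact_mod_cast h2)
    exact I.live_of_mem hx
  -- Every vertex other than the root `α` is matched, hence is the tail of a matched arc. Dropping
  -- the roots accounts for the `+ 1` in the limit.
  have h1 : (D.biUnion fun α => (s.struct α).verts.erase α).card ≤ (matchedArcs M).card := by
    refine (Finset.card_le_card fun x hx => ?_).trans (Finset.card_image_le (f := Prod.fst))
    obtain ⟨α, hα, hx⟩ := Finset.mem_biUnion.1 hx
    obtain ⟨hn, hx⟩ := Finset.mem_erase.1 hx
    obtain ⟨y, hy⟩ := (hlive α hα).tree.cov x hx hn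
    exact Finset.mem_image.2 ⟨(x, y), mem_matchedArcs.2 hy, rfl⟩
  rw [Finset.card_biUnion] at h1
  · calc 6 / h * (D.card : ℝ) = ∑ α ∈ D, 6 / h := by rw [Finset.sum_const, nsmul_eq_mul, mul_comm]
      _ ≤ ∑ α ∈ D, (((s.struct α).verts.erase α).card : ℝ) := by
        refine Finset.sum_le_sum fun α hα => ?_
        have h2 := Finset.card_erase_add_one (hlive α hα).tree.self
        have h3 := (Finset.mem_filter.1 hα).2
        rw [← h2] at h3
        push_cast at h3
        linarith
      _ ≤ _ := by exact_mod_cast h1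
  · intro α _ β _ hn
    refine Finset.disjoint_left.2 fun x hx hx' => ?_
    exact hn (I.disj _ _ x (Finset.mem_of_mem_erase hx) (Finset.mem_of_mem_erase hx'))

/-- Active structures on hold are charged to matched arcs. The modified ones and those that moved
back are charged to the fall of the potential. -/
theorem Inv.passBundle (I : Inv M s) (hM : M.IsMatching) {h : ℝ} (hh : 0 < h)
    (hp : PassBundle M h s s') : Inv M s' ∧ (∀ α, s'.IsActive M α → s.IsActive M α) ∧
      6 / h * (({α | s'.IsActive M α}.ncard : ℝ) + potential M s') ≤
        (matchedArcs M).card + 6 / h * potential M s := by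
  obtain ⟨L₁, L₂, s₁, s₂, s₃, -, -, h1, h2, h3, rfl⟩ := hp
  have I₀ : Inv M (s.mark h) := ⟨I.lam, I.sub, I.disj, I.live⟩
  have p1 := I₀.pass_progress (fun _ _ _ I h => I.extendStep_progress hM h) h1
  have p2 := p1.trans (p1.inv.contractAll_progress hM h2.1)
  have p3 := p2.trans (p2.inv.pass_progress (fun _ _ _ I h => I.augmentStep_progress h) h3)
  obtain ⟨I', hact, hpot⟩ := p3.inv.backtrack
  refine ⟨I', fun α h => p3.active α (hact α h), ?_⟩
  have hle := p3.le
  -- Marking clears all modified flags, so each bundle starts with no debt for modified structures.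
  have h0 : activeModified M (s.mark h) = ∅ := by
    ext α; simp [mem_activeModified, mark]
  have h0' : potential M (s.mark h) = potential M s := rfl
  rw [h0, h0', Finset.card_empty, add_zero] at hle
  set H := Finset.univ.filter fun α : V => 6 / h + 1 ≤ ((s.struct α).verts.card : ℝ)
  set D := Finset.univ.filter fun α => s₃.backtrack.IsActive M α ∧ α ∉ s₃.onHold ∧ α ∉ s₃.modified
  have hsub : {α | s₃.backtrack.IsActive M α} ⊆ ((H ∪ activeModified M s₃ ∪ D : Finset V) : Set V) := by
    intro α hα
    have hα' : s₃.backtrack.IsActive M α := hα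
    simp only [Finset.coe_union, Set.mem_union, Finset.mem_coe, mem_activeModified, H, D,
      Finset.mem_filter, Finset.mem_univ, true_and]
    by_cases h4 : α ∈ s₃.onHold
    · rw [p3.onHold] at h4
      exact .inl (.inl h4)
    · by_cases h5 : α ∈ s₃.modified
      · exact .inl (.inr ⟨hact α hα', h5⟩)
      · exact .inr ⟨hα', h4, h5⟩
  have hcard : {α | s₃.backtrack.IsActive M α}.ncard ≤
      H.card + (activeModified M s₃).card + D.card := by
    refine (Set.ncard_le_ncard hsub (Set.toFinite _)).trans ?_
    rw [Set.ncard_coe_finset]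
    exact (Finset.card_union_le _ _).trans (Nat.add_le_add_right (Finset.card_union_le _ _) _)
  have hfin : {α | s₃.backtrack.IsActive M α}.ncard + potential M s₃.backtrack ≤
      H.card + potential M s := by omega
  have hfin' : (({α | s₃.backtrack.IsActive M α}.ncard : ℝ) + potential M s₃.backtrack) ≤
      H.card + potential M s := by exact_mod_cast hfin
  calc _ ≤ 6 / h * ((H.card : ℝ) + potential M s) := by gcongr
    _ = 6 / h * (H.card : ℝ) + 6 / h * potential M s := mul_add _ _ _
    _ ≤ _ := by gcongr; exact I.card_large_le hh

/-! ### The initial state and summation over the phase -/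

theorem inv_initial (M : G.Subgraph) (ε : ℝ) : Inv M (initial M ε) := by
  have hst : ∀ α, ((initial M ε).struct α = FreeStructure.single α ∧ IsFree M α) ∨
      (initial M ε).struct α = FreeStructure.empty V := by
    intro α
    by_cases h : IsFree M α
    · exact .inl ⟨if_pos h, h⟩
    · exact .inr (if_neg h)
  have hverts : ∀ α x, x ∈ ((initial M ε).struct α).verts → x = α := by
    intro α x hx
    rcases hst α with ⟨h, -⟩ | h <;> rw [h] at hx
    · simpa [FreeStructure.single] using hx
    · simp [FreeStructure.empty] at hx
  have hbl : ∀ α, ∀ B ∈ ((initial M ε).struct α).blossoms,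
      B = {α} ∧ B ⊆ ((initial M ε).struct α).verts := by
    intro α B hB
    rcases hst α with ⟨h, -⟩ | h <;> rw [h] at hB ⊢
    · have : B = {α} := by simpa [FreeStructure.single] using hB
      subst this
      exact ⟨rfl, by simp [FreeStructure.single]⟩
    · simp [FreeStructure.empty] at hB
  have hfam : ∀ B ∈ (initial M ε).family, ∃ v, B = {v} := by
    intro B hB
    rcases mem_family.1 hB with h | ⟨α, h⟩
    exacts [h, ⟨α, (hbl α B h).1⟩]
  have hroot : ∀ x, (initial M ε).root x = {x} := by
    intro x
    ext y
    rw [Finset.mem_singleton]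
    constructor
    · intro hy
      obtain ⟨B, hB, h1, h2⟩ := mem_root_iff.1 hy
      obtain ⟨v, rfl⟩ := hfam B hB
      rw [Finset.mem_singleton] at h1 h2
      rw [h1, h2]
    · rintro rfl
      exact self_mem_root _ _
  refine ⟨?_, fun α B hB => (hbl α B hB).2, ?_, ?_⟩
  · intro B hB x hx y hy
    obtain ⟨v, rfl⟩ := hfam B hB
    rw [Finset.mem_singleton] at hx hy
    rw [hx, hy]
  · intro α β x hx hy
    rw [← hverts α x hx, ← hverts β x hy]
  · intro α
    rcases hst α with ⟨h, hα⟩ | h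
    · refine .inr ?_
      rw [h]
      have hA : ∀ a, a ∉ (FreeStructure.single α).arcs := by simp [FreeStructure.single]
      have hS : ∀ x, x ∈ (FreeStructure.single α).verts ↔ x = α := by simp [FreeStructure.single]
      have hW : ∀ W, (FreeStructure.single α).working = some W → W = {α} := fun W h =>
        (Option.some.inj h).symm
      refine ⟨⟨(hS α).2 rfl, hα, self_mem_root _, ?_, fun _ _ h => absurd h (hA _),
        fun _ _ _ _ h => absurd h (hA _), fun _ _ h => absurd h (hA _), ?_,
        fun _ _ h => absurd h (hA _), fun _ _ h => absurd h (hA _), ?_, ?_⟩,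
        fun _ _ h => absurd h (hA _), ?_, fun _ _ _ _ _ _ h => absurd h (hA _)⟩
      · intro x hx y hy
        rw [hroot, hroot, Finset.singleton_inj] at hy
        rwa [hy]
      · intro x hx
        rw [(hS x).1 hx]
      · intro x hx y hy
        rw [(hS x).1 hx] at hy
        exact absurd hy (hα y)
      · intro x hx hn
        exact absurd ((hS x).1 hx) hn
      · intro W h
        exact .inl ((hW W h).trans (hroot α).symm)
    · exact .inl h

theorem potential_initial (M : G.Subgraph) (ε : ℝ) :
    potential M (initial M ε) = 3 * ((matchedArcs M).card * (labelMax ε + 1)) := by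
  have h1 : activeArcs M (initial M ε) = ∅ := by
    ext a
    simp only [Set.mem_empty_iff_false, iff_false]
    rintro ⟨α, W, -, h, -⟩
    by_cases hα : IsFree M α <;>
      simp [initial, hα, FreeStructure.single, FreeStructure.empty] at h
  have h2 : (initial M ε : PhaseState V).label = fun _ => labelMax ε + 1 := rfl
  rw [potential, h1, h2, Finset.sum_const, smul_eq_mul, Set.ncard_empty, add_zero]

theorem card_matchedArcs_le (M : G.Subgraph) : (matchedArcs M).card ≤ 2 * M.edgeSet.ncard := by
  have h1 := Finset.card_le_mul_card_image (f := fun a : V × V => s(a.1, a.2)) (matchedArcs M) 2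
    (fun e _ => by
      induction e with
      | h x y =>
        refine (Finset.card_le_card (t := {(x, y), (y, x)}) fun a ha => ?_).trans
          Finset.card_le_two
        have h2 := (Finset.mem_filter.1 ha).2
        rw [Sym2.eq_iff] at h2
        rw [Finset.mem_insert, Finset.mem_singleton, Prod.ext_iff, Prod.ext_iff]
        exact h2)
  refine h1.trans (Nat.mul_le_mul_left 2 ?_)
  rw [← Set.ncard_coe_finset]
  refine Set.ncard_le_ncard ?_ (Set.toFinite _)
  intro e he
  obtain ⟨a, ha, rfl⟩ := Finset.mem_image.1 (Finset.mem_coe.1 he)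
  exact M.mem_edgeSet.2 (mem_matchedArcs.1 ha)

/-- The bounds of the single bundles telescope in the potential. Each earlier count of active
structures may be replaced by the current one because active sets only shrink. -/
theorem afterBundles_bound (hM : M.IsMatching) {ε h : ℝ} (hh : 0 < h) {n : ℕ}
    (hs : AfterBundles M ε h n s) : Inv M s ∧
      6 / h * (n * ({α | s.IsActive M α}.ncard : ℝ) + potential M s) ≤
        n * (matchedArcs M).card + 6 / h * potential M (initial M ε) := by
  induction hs with
  | start => exact ⟨inv_initial M ε, by simp⟩
  | @next n s s' _ hp ih =>
    obtain ⟨I, hb⟩ := ih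
    obtain ⟨I', hact, hb'⟩ := I.passBundle hM hh hp
    refine ⟨I', ?_⟩
    have h1 : ({α | s'.IsActive M α}.ncard : ℝ) ≤ ({α | s.IsActive M α}.ncard : ℝ) := by
      exact_mod_cast Set.ncard_le_ncard hact (Set.toFinite _)
    have h2 : 6 / h * (n * ({α | s'.IsActive M α}.ncard : ℝ)) ≤
        6 / h * (n * ({α | s.IsActive M α}.ncard : ℝ)) := by gcongr
    push_cast
    linarith

end PhaseState

end MatchingPhase

/-! ### Numerical conclusion -/

theorem mainTheorem7 {V : Type*} [Fintype V] (G : SimpleGraph V) (M : G.Subgraph)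
    (hM : M.IsMatching) (ε h : ℝ) (hε : ∃ k : ℕ, ε = 1 / 2 ^ k)
    (hh : MatchingPhase.IsScale ε h) (s : MatchingPhase.PhaseState V)
    (hs : MatchingPhase.IsPhaseEnd M ε h s) :
    ({α : V | s.IsActive M α}.ncard : ℝ) ≤ h * (M.edgeSet.ncard : ℝ) := by
  obtain ⟨k, rfl⟩ := hε
  obtain ⟨j, -, rfl, -⟩ := hh
  have hj : (0 : ℝ) < 2 ^ j := by positivity
  have hk : (1 : ℝ) ≤ 2 ^ k := one_le_pow₀ (by norm_num)
  have hb := (MatchingPhase.PhaseState.afterBundles_bound hM (by positivity) hs).2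
  -- The floor loses nothing here, since `72 / (h * ε)` is an integer for powers of two.
  have hn : (MatchingPhase.bundleCount (1 / 2 ^ k) (1 / 2 ^ j) : ℝ) = 72 * 2 ^ j * 2 ^ k := by
    have : (72 : ℝ) / (1 / 2 ^ j * (1 / 2 ^ k)) = ((72 * 2 ^ j * 2 ^ k : ℕ) : ℝ) := by
      push_cast
      field_simp
    rw [MatchingPhase.bundleCount, this, Nat.floor_natCast]
    push_cast
    ring
  have hl : (MatchingPhase.labelMax (1 / 2 ^ k) : ℝ) ≤ 3 * 2 ^ k := by
    refine (Nat.floor_le (by positivity)).trans_eq ?_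
    field_simp
  have hm : ((MatchingPhase.PhaseState.matchedArcs M).card : ℝ) ≤ 2 * M.edgeSet.ncard := by
    exact_mod_cast MatchingPhase.PhaseState.card_matchedArcs_le M
  rw [MatchingPhase.PhaseState.potential_initial, hn] at hb
  push_cast at hb
  have h6 : (6 : ℝ) / (1 / 2 ^ j) = 6 * 2 ^ j := by field_simp
  rw [h6] at hb
  set N : ℝ := ({α : V | s.IsActive M α}.ncard : ℝ)
  set m : ℝ := (M.edgeSet.ncard : ℝ)
  set c : ℝ := ((MatchingPhase.PhaseState.matchedArcs M).card : ℝ)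
  set ℓ : ℝ := (MatchingPhase.labelMax (1 / 2 ^ k) : ℝ)
  have hc : 0 ≤ c := Nat.cast_nonneg _
  have hpot : (0 : ℝ) ≤ MatchingPhase.PhaseState.potential M s := Nat.cast_nonneg _
  -- The extra 1 in the initial labels is absorbed by `1 ≤ 2 ^ k`, giving `3 * 2 ^ k + 1 ≤ 4 * 2 ^
  -- k`.
  have hcl : c * (ℓ + 1) ≤ c * (4 * 2 ^ k) := by gcongr; linarith
  -- The coefficient 24 is `12 + 12`: the structures on hold contribute `72 / 6` and the initial
  -- potential `3 * 4`.
  have h1 : 6 * 2 ^ j * (72 * 2 ^ j * 2 ^ k * N) ≤ 6 * 2 ^ j * (24 * 2 ^ k * c) := by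
    have h2 : 6 * 2 ^ j * (3 * (c * (ℓ + 1))) ≤ 6 * 2 ^ j * (3 * (c * (4 * 2 ^ k))) := by gcongr
    have h3 : 0 ≤ 6 * 2 ^ j * (MatchingPhase.PhaseState.potential M s : ℝ) := by positivity
    linarith
  have h2 : 72 * 2 ^ j * 2 ^ k * N ≤ 24 * 2 ^ k * c := le_of_mul_le_mul_left h1 (by positivity)
  have h3 : 2 ^ k * (72 * 2 ^ j * N) ≤ 2 ^ k * (24 * c) := by linarith
  have h4 : 72 * 2 ^ j * N ≤ 24 * c := le_of_mul_le_mul_left h3 (by positivity)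
  rw [one_div, inv_mul_eq_div, le_div_iff₀ hj]
  have hm0 : 0 ≤ m := Nat.cast_nonneg _
  -- What is left is `N ≤ c / (3 * 2 ^ j)` with `c ≤ 2 * m`, so the bound holds with a factor `2 /
  -- 3` to spare.
  linarith
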